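/- Let $k\ge 0$ and let $m_1,\dots,m_k\ge 1$ be pairwise distinct integers. The spider graph $\Gamma=\mathcal O_{m_1,\dots,m_k}$ consists of a central vertex $v$ and $k$ disjoint paths $P_{m_1},\dots,P_{m_k}$ ($P_m$ having $m$ vertices), each joined to $v$ by one edge at one of its endpoints. Let $V$ and $E$ be its vertex and edge sets and $n=\sum_{j=1}^k m_j=|V|-1$. Write $X_w,Z_w$ for the Pauli operators acting on the qubit $w$. The standard dynamical Lie algebra (DLA) $\mathfrak g_{\Gamma,\mathrm{std}}$ is the real Lie algebra of operators on $(\mathbb C^2)^{\otimes V}$ generated under commutators by $i\sum_{w\in V}X_w$ and $i\sum_{ww'\in E}Z_wZ_{w'}$. The standard reduced DLA $\mathfrak g^v_{\Gamma,\mathrm{std}}$ at $v$ is the real Lie algebra of operators on $(\mathbb C^2)^{\otimes (V\setminus\{v\})}$ generated by $$i\sum_{w\ne v}X_w\qquad\text{and}\qquad i\sum_{ww'\in E,\;w,w'\neq v}Z_wZ_{w'}+i\sum_{vw\in E}Z_w ,$$ and the free reduced DLA $\mathfrak g^v_{\Gamma,\mathrm{free}}$ is generated by the individual terms $iX_w$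 ($w\ne v$), $iZ_wZ_{w'}$ ($ww'\in E$, $w,w'\ne v$) and $iZ_w$ ($vw\in E$). Then $$\mathfrak g^v_{\Gamma,\mathrm{std}}=\mathfrak g^v_{\Gamma,\mathrm{free}}\;\cong\;\bigoplus_{j=1}^k\mathfrak{so}(2m_j+1),\qquad \dim_{\mathbb R}\mathfrak g^v_{\Gamma,\mathrm{std}}=2\sum_{j=1}^k m_j^2+n\;\le\;2n^2+n,$$ where $\mathfrak{so}(N)$ is the Lie algebra of real skew-symmetric $N\times N$ matrices. By contrast, the full standard DLA grows exponentially: there are absolute constants $c>0$ and $a>1$ such that, for every $k\ge 3$ and all pairwise distinct $m_1,\dots,m_k\ge1$, $$\dim_{\mathbb R}\mathfrak g_{\mathcal O_{m_1,\dots,m_k},\mathrm{std}}\;\ge\; c\,a^{\,n}.$$ -/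

import Mathlib

open scoped DirectSum

attribute [local instance 100] LieRing.ofAssociativeRing

noncomputable section

namespace QAOA

/-- Operators on the Hilbert space `(ℂ²)^{⊗ V}` of qubits indexed by `V`, as matrices in the
computational basis `{|x⟩ : x ∈ {0,1}^V}`. -/
abbrev Op (V : Type) : Type := Matrix (V → Bool) (V → Bool) ℂ

/-- The Pauli operator `X_w`, which flips bit `w`. -/
def pauliX {V : Type} [Fintype V] [DecidableEq V] (w : V) : Op V :=
  Matrix.of fun x y => if x = Function.update y w (!(y w)) then 1 else 0

/-- The Pauli operator `Z_w`, with `Z_w |x⟩ = (-1)^{x_w} |x⟩`. -/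
def pauliZ {V : Type} [Fintype V] [DecidableEq V] (w : V) : Op V :=
  Matrix.diagonal fun x => if x w then -1 else 1

theorem pauliZ_mul_comm {V : Type} [Fintype V] [DecidableEq V] (a b : V) :
    pauliZ a * pauliZ b = pauliZ b * pauliZ a := by
  unfold pauliZ
  rw [Matrix.diagonal_mul_diagonal, Matrix.diagonal_mul_diagonal]
  congr 1
  funext x
  exact mul_comm _ _

/-- The operator `Z_w Z_w'` attached to an unordered pair `{w, w'}`. -/
def pauliZZ {V : Type} [Fintype V] [DecidableEq V] (e : Sym2 V) : Op V :=
  Sym2.lift ⟨fun a b => pauliZ a * pauliZ b, pauliZ_mul_comm⟩ e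

/-- The mixer Hamiltonian `∑_w X_w`. -/
def mixer (V : Type) [Fintype V] [DecidableEq V] : Op V := ∑ w : V, pauliX w

/-- The MaxCut problem Hamiltonian `∑_{ww' ∈ E} Z_w Z_w'`. -/
def problem {V : Type} [Fintype V] [DecidableEq V] (G : SimpleGraph V)
    [DecidableRel G.Adj] : Op V := ∑ e ∈ G.edgeFinset, pauliZZ e

/-- The standard dynamical Lie algebra of MaxCut on `G`: the real Lie algebra generated by
`i H_M` and `i H_P`. -/
def stdDLA {V : Type} [Fintype V] [DecidableEq V] (G : SimpleGraph V)
    [DecidableRel G.Adj] :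
    LieSubalgebra ℝ (Op V) :=
  LieSubalgebra.lieSpan ℝ (Op V) {Complex.I • mixer V, Complex.I • problem G}

/-- The vertices of the reduced graph. -/
abbrev Rest {V : Type} (v : V) : Type := {w : V // w ≠ v}

/-- The reduced graph: `G` with the vertex `v` removed. -/
abbrev reducedGraph {V : Type} (G : SimpleGraph V) (v : V) : SimpleGraph (Rest v) := G.comap Subtype.val

/-- The reduced problem Hamiltonian (the bit at `v` is fixed, so `Z_v` becomes `1`):
`∑_{ww' ∈ E, w, w' ≠ v} Z_w Z_w' + ∑_{vw ∈ E} Z_w`. -/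
def reducedProblem {V : Type} [Fintype V] [DecidableEq V] (G : SimpleGraph V)
    [DecidableRel G.Adj] (v : V) : Op (Rest v) :=
  (∑ e ∈ (reducedGraph G v).edgeFinset, pauliZZ e) +
    ∑ w : Rest v with G.Adj v w.val, pauliZ w

/-- The standard reduced dynamical Lie algebra of MaxCut on `G` at `v`. -/
def reducedStdDLA {V : Type} [Fintype V] [DecidableEq V] (G : SimpleGraph V)
    [DecidableRel G.Adj] (v : V) : LieSubalgebra ℝ (Op (Rest v)) :=
  LieSubalgebra.lieSpan ℝ (Op (Rest v))
    {Complex.I • mixer (Rest v), Complex.I • reducedProblem G v}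

/-- The free reduced dynamical Lie algebra of MaxCut on `G` at `v`, generated by the individual
terms of the two reduced Hamiltonians. -/
def reducedFreeDLA {V : Type} [Fintype V] [DecidableEq V] (G : SimpleGraph V)
    [DecidableRel G.Adj] (v : V) : LieSubalgebra ℝ (Op (Rest v)) :=
  LieSubalgebra.lieSpan ℝ (Op (Rest v))
    ({A | ∃ w : Rest v, A = Complex.I • pauliX w} ∪
      {A | ∃ e ∈ (reducedGraph G v).edgeSet, A = Complex.I • pauliZZ e} ∪
      {A | ∃ w : Rest v, G.Adj v w.val ∧ A = Complex.I • pauliZ w})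

/-- Vertices of the spider with `k` arms of `m 0, …, m (k-1)` vertices: the centre `none`, and the
`i`-th vertex (counted from the centre, starting at `0`) `some ⟨j, i⟩` of the `j`-th arm. -/
abbrev SpiderVertex {k : ℕ} (m : Fin k → ℕ) : Type := Option (Σ j : Fin k, Fin (m j))

/-- `b` follows immediately after `a` on the way outwards from the centre. -/
def SpiderStep {k : ℕ} (m : Fin k → ℕ) : SpiderVertex m → SpiderVertex m → Prop
  | none, some q => q.2.val = 0
  | some p, some q => p.1 = q.1 ∧ p.2.val + 1 = q.2.val
  | _, none => False

instance {k : ℕ} (m : Fin k → ℕ) : DecidableRel (SpiderStep m)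
  | none, some q => inferInstanceAs (Decidable (q.2.val = 0))
  | some p, some q => inferInstanceAs (Decidable (p.1 = q.1 ∧ p.2.val + 1 = q.2.val))
  | none, none => inferInstanceAs (Decidable False)
  | some _, none => inferInstanceAs (Decidable False)

/-- The spider graph: `k` paths with `m 0, …, m (k-1)` vertices, each joined by one of its ends
to a central vertex. -/
def spider {k : ℕ} (m : Fin k → ℕ) : SimpleGraph (SpiderVertex m) :=
  SimpleGraph.fromRel (SpiderStep m)

instance {k : ℕ} (m : Fin k → ℕ) : DecidableRel (spider m).Adj :=
  inferInstanceAs (DecidableRel (SimpleGraph.fromRel (SpiderStep m)).Adj)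

/-- The central vertex of the spider. -/
abbrev spiderCentre {k : ℕ} (m : Fin k → ℕ) : SpiderVertex m := none

end QAOA

end

/-! Split both Hamiltonians into individual terms. Each term squares to `-1`, and two terms either
commute or anticommute. The anticommutation graph joins a mixer term to the edge terms at its qubit:
in the full case it is the spider with every edge subdivided, in the reduced case a disjoint union
of paths with `2 * m j` vertices.

Individual terms are isolated by a parity argument. If the sums over `I` and `K` lie in a Lie
algebra and `I` is independent, a polynomial in the adjoint action of the first sum selects the
terms of `K` with an odd number of neighbours in `I` (`FrustrationFamily.sum_odd_mem`). So the
partition into mixer and edge terms refines to one that is equitable modulo two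
(`FrustrationFamily.exists_equitable`). In such a partition, two arms with equivalent innermost edge
terms run in lockstep out to their tips and have equal length (`Equitable.arm_eq`), which distinct
lengths forbid. This separates the innermost terms in the reduced case. In the full case with `3 ≤
k` it isolates the centre, which would otherwise share a cell with a vertex of degree at most two.
Singleton cells then spread outwards, and every term is in the standard algebra.

For the reduced algebra, the path of an arm consists of the products of consecutive Majorana
operators, `2 * m j + 1` in number, starting with the parity operator of the arm. Their bilinears
give the spin representation of `so(2 * m j + 1)`, and different arms commute (`armHom_injective`,
`range_armHom`).

For the full algebra, brackets through the centre produce products of terms from three different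
arms. These toggle pairs of bits in strings of `X` operators (`xString_toggle`). With the shortest
arm as control, at least `n / 2 - 1` bits can be prescribed freely, giving exponentially many
independent strings. -/

noncomputable section

namespace QAOA

/-! ### Parity refinement for anticommuting families -/

section Abstract

variable {A : Type*} [Ring A]

/-- Polynomials in two elements that agree after multiplication by a commuting element `e`. -/
theorem aeval_mul_congr [Algebra ℝ A] {a b e : A} (hab : Commute a b) (h : a * e = b * e)
    (f : Polynomial ℝ) : Polynomial.aeval a f * e = Polynomial.aeval b f * e := by
  have hpow : ∀ n : ℕ, a ^ n * e = b ^ n * e := by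
    intro n
    induction n with
    | zero => simp
    | succ n ih =>
      rw [pow_succ', mul_assoc, ih, ← mul_assoc, (hab.pow_right n).eq, mul_assoc, h, ← mul_assoc,
        ← pow_succ]
  induction f using Polynomial.induction_on' with
  | add p q hp hq => simp [add_mul, hp, hq]
  | monomial n c => simp [Polynomial.aeval_monomial, mul_assoc, hpow]

/-- A sum of `d` commuting involutions is annihilated by every polynomial vanishing at
`d, d - 2, …, -d`. -/
theorem aeval_sum_involutions_eq_zero [Algebra ℝ A] {ι : Type*} (s : ι → A) (I : Finset ι)
    (hs : ∀ p ∈ I, s p * s p = 1) (hc : ∀ p ∈ I, ∀ q ∈ I, Commute (s p) (s q))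
    (f : Polynomial ℝ) (hf : ∀ i ≤ I.card, f.eval ((I.card : ℝ) - 2 * i) = 0) :
    Polynomial.aeval (∑ p ∈ I, s p) f = 0 := by
  classical
  induction I using Finset.induction_on generalizing f with
  | empty =>
    have h0 := hf 0 (by simp)
    simp only [Finset.card_empty, Nat.cast_zero, mul_zero, sub_zero] at h0
    rw [Finset.sum_empty, ← map_zero (algebraMap ℝ A), Polynomial.aeval_algebraMap_apply,
      Polynomial.coe_aeval_eq_eval, h0, map_zero]
  | insert p I hp ih =>
    rw [Finset.sum_insert hp]
    rw [Finset.card_insert_of_notMem hp] at hf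
    set S := ∑ q ∈ I, s q with hS
    have hpS : Commute (s p) S := Commute.sum_right _ _ _ fun q hq =>
      hc p (Finset.mem_insert_self _ _) q (Finset.mem_insert_of_mem hq)
    have hpp := hs p (Finset.mem_insert_self _ _)
    -- The factor `1 + ε • s p` is twice the projection onto the `ε`-eigenspace of `s p`, where `s
    -- p` may be replaced by the scalar `ε`. The two projections for `ε = ±1` add up to the
    -- identity.
    have key : ∀ ε : ℝ, s p * (1 + ε • s p) = ε • (1 + ε • s p) →
        (∀ i ≤ I.card, f.eval ((I.card : ℝ) - 2 * i + ε) = 0) →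
        Polynomial.aeval (s p + S) f * (1 + ε • s p) = 0 := by
      intro ε hε hfε
      have hcomp := ih (fun q hq => hs q (Finset.mem_insert_of_mem hq))
        (fun q hq r hr => hc q (Finset.mem_insert_of_mem hq) r (Finset.mem_insert_of_mem hr))
        (f.comp (Polynomial.X + Polynomial.C ε)) (fun i hi => by simpa using hfε i hi)
      rw [Polynomial.aeval_comp] at hcomp
      simp only [map_add, Polynomial.aeval_X, Polynomial.aeval_C] at hcomp
      rw [aeval_mul_congr (b := S + algebraMap ℝ A ε), hcomp, zero_mul]
      · exact (hpS.add_left (Commute.refl S)).add_right (Algebra.commutes _ _).symm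
      · rw [add_mul, add_mul, hε, Algebra.smul_def, add_comm]
    have h1 := key 1 (by simp [mul_add, hpp, add_comm]) (fun i hi => by
      have := hf i (by omega)
      push_cast at this
      rw [← this]; congr 1; ring)
    have h2 := key (-1) (by simp [mul_add, hpp, add_comm]) (fun i hi => by
      have := hf (i + 1) (by omega)
      push_cast at this
      rw [← this]; congr 1; ring)
    have h3 : (2 : ℝ) • Polynomial.aeval (s p + S) f = 0 := by
      have := congrArg₂ (· + ·) h1 h2
      simp only [← mul_add, add_zero] at this
      rw [← this, one_smul, neg_one_smul, show (1 + s p + (1 + -s p) : A) = (2 : ℝ) • 1 by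
        rw [two_smul]; abel, mul_smul_comm, mul_one]
    exact (smul_eq_zero.1 h3).resolve_left two_ne_zero

/-- Elements squaring to `-1` that pairwise anticommute or commute, according to a relation. -/
structure FrustrationFamily {ι : Type*} (adj : ι → ι → Prop) (h : ι → A) : Prop where
  symm : ∀ x y, adj x y → adj y x
  sq : ∀ x, h x * h x = -1
  anti : ∀ x y, adj x y → h x * h y = -(h y * h x)
  comm : ∀ x y, ¬ adj x y → Commute (h x) (h y)

/-- On a term with `d` neighbours in an independent set, the squared adjoint action has eigenvalues
`-4 * w ^ 2` with `w` of the parity of `d`. Squaring makes the spectrum real, so real interpolation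
suffices; the nodes are distinct because `w` is natural. -/
theorem exists_parity_polynomial (K : ℕ) : ∃ g : Polynomial ℝ, ∀ w : ℕ, w ≤ K →
    g.eval (-4 * (w : ℝ) ^ 2) = if Odd w then 1 else 0 := by
  refine ⟨Lagrange.interpolate (Finset.range (K + 1)) (fun w : ℕ => -4 * (w : ℝ) ^ 2)
    (fun w => if Odd w then 1 else 0), fun w hw => ?_⟩
  refine Lagrange.eval_interpolate_at_node (v := fun w : ℕ => -4 * (w : ℝ) ^ 2) _ ?_
    (Finset.mem_range.2 (by omega))
  intro a _ b _ hab
  have h1 : (a : ℝ) ^ 2 = (b : ℝ) ^ 2 := by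
    simp only at hab
    linarith
  exact_mod_cast (pow_left_inj₀ (Nat.cast_nonneg a) (Nat.cast_nonneg b) two_ne_zero).1 h1

theorem aeval_ad_mem [Algebra ℝ A] (L : LieSubalgebra ℝ A) {P y : A} (hP : P ∈ L) (hy : y ∈ L)
    (f : Polynomial ℝ) : Polynomial.aeval (LieAlgebra.ad ℝ A P) f y ∈ L := by
  have hpow : ∀ n : ℕ, ((LieAlgebra.ad ℝ A P) ^ n) y ∈ L := by
    intro n
    induction n with
    | zero => simpa
    | succ n ih =>
      rw [pow_succ', Module.End.mul_apply, LieAlgebra.ad_apply]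
      exact L.lie_mem hP ih
  induction f using Polynomial.induction_on' with
  | add p q hp hq =>
    rw [map_add, LinearMap.add_apply]
    exact L.add_mem hp hq
  | monomial n c =>
    rw [Polynomial.aeval_monomial, Algebra.algebraMap_eq_smul_one, smul_mul_assoc, one_mul]
    exact L.smul_mem c (hpow n)

variable {ι : Type*} {adj : ι → ι → Prop} {h : ι → A}

/-- Neighbours of `q` anticommute with `h q` and the other terms commute with it, so one bracket
multiplies `h q` on the right by `-2` times the sum of the neighbours. Independence of `I` makes
this factor commute with the whole sum, so iteration yields its powers. -/
theorem FrustrationFamily.aeval_ad_sum [Algebra ℝ A] [DecidableRel adj]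
    (H : FrustrationFamily adj h)
    (I : Finset ι) (hI : ∀ p ∈ I, ∀ q ∈ I, ¬ adj p q) (q : ι)
    (f : Polynomial ℝ) :
    Polynomial.aeval (LieAlgebra.ad ℝ A (∑ p ∈ I, h p)) f (h q) =
      h q * Polynomial.aeval ((-2 : ℝ) • ∑ p ∈ I with adj q p, h p) f := by
  set S := ∑ p ∈ I with adj q p, h p with hS
  set R := ∑ p ∈ I with ¬ adj q p, h p with hR
  have hP : ∑ p ∈ I, h p = S + R := (Finset.sum_filter_add_sum_filter_not I _ _).symm
  have hSq : S * h q = -(h q * S) := by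
    rw [hS, Finset.sum_mul, Finset.mul_sum, ← Finset.sum_neg_distrib]
    exact Finset.sum_congr rfl fun p hp => H.anti p q (H.symm _ _ (Finset.mem_filter.1 hp).2)
  have hRq : R * h q = h q * R := by
    rw [hR, Finset.sum_mul, Finset.mul_sum]
    exact Finset.sum_congr rfl fun p hp => (H.comm q p (Finset.mem_filter.1 hp).2).eq.symm
  have hSR : Commute S R := by
    refine Commute.sum_left _ _ _ fun p hp => Commute.sum_right _ _ _ fun r hr => H.comm p r ?_
    exact hI p (Finset.mem_filter.1 hp).1 r (Finset.mem_filter.1 hr).1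
  have hpow : ∀ n : ℕ, ((LieAlgebra.ad ℝ A (∑ p ∈ I, h p)) ^ n) (h q) =
      h q * ((-2 : ℝ) • S) ^ n := by
    intro n
    induction n with
    | zero => simp
    | succ n ih =>
      rw [pow_succ', Module.End.mul_apply, LieAlgebra.ad_apply, ih, hP, Ring.lie_def]
      have hc : Commute (((-2 : ℝ) • S) ^ n) (S + R) :=
        (((Commute.refl S).add_right hSR).smul_left _).pow_left n
      rw [mul_assoc, hc.eq, ← mul_assoc, ← mul_assoc, add_mul, hSq, hRq, pow_succ', mul_add,
        ← mul_assoc, ← sub_mul, mul_smul_comm]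
      congr 1
      module
  induction f using Polynomial.induction_on' with
  | add p q hp hq => simp only [map_add, LinearMap.add_apply, hp, hq, mul_add]
  | monomial n c =>
    simp only [Polynomial.aeval_monomial, Algebra.algebraMap_eq_smul_one, smul_mul_assoc, one_mul,
      LinearMap.smul_apply, hpow, mul_smul_comm]

variable [Algebra ℂ A] [Algebra ℝ A]

/-- Restricting a sum to the terms with an odd number of neighbours in an independent set. -/
theorem FrustrationFamily.sum_odd_mem [DecidableRel adj] (H : FrustrationFamily adj h)
    (L : LieSubalgebra ℝ A) (I K : Finset ι)
    (hI : ∀ p ∈ I, ∀ q ∈ I, ¬ adj p q) (hIL : ∑ p ∈ I, h p ∈ L) (hKL : ∑ q ∈ K, h q ∈ L) :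
    ∑ q ∈ K with Odd (I.filter (adj q)).card, h q ∈ L := by
  obtain ⟨g, hg⟩ := exists_parity_polynomial I.card
  have hmem := aeval_ad_mem L hIL hKL (g.comp (Polynomial.X ^ 2))
  rw [map_sum] at hmem
  convert hmem using 1
  rw [Finset.sum_filter]
  refine Finset.sum_congr rfl fun q _ => ?_
  rw [H.aeval_ad_sum I hI]
  set J := I.filter (adj q) with hJ
  have hJI : ∀ p ∈ J, p ∈ I := fun p hp => (Finset.mem_filter.1 hp).1
  have hJc : J.card ≤ I.card := Finset.card_filter_le _ _
  -- Multiplication by `-i` turns square roots of `-1` into commuting involutions, whose sum has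
  -- eigenvalues among `d - 2 * i` with `d = J.card`.
  set s : ι → A := fun p => (-Complex.I) • h p with hs
  have hsum : ((-2 : ℝ) • ∑ p ∈ J, h p) ^ 2 = (-4 : ℝ) • (∑ p ∈ J, s p) ^ 2 := by
    rw [hs, ← Finset.smul_sum, smul_pow, smul_pow]
    norm_num
  have hann := aeval_sum_involutions_eq_zero s J
    (fun p _ => by simp [hs, H.sq, smul_smul])
    (fun p hp r hr =>
      ((H.comm p r (hI p (hJI p hp) r (hJI r hr))).smul_left _).smul_right _)
    (g.comp (Polynomial.C (-4) * Polynomial.X ^ 2) - Polynomial.C (if Odd J.card then 1 else 0))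
    (fun i hi => by
      obtain ⟨w, hwK, hw2, hodd⟩ : ∃ w : ℕ, w ≤ I.card ∧
          ((J.card : ℝ) - 2 * i) ^ 2 = (w : ℝ) ^ 2 ∧ (Odd w ↔ Odd J.card) := by
        refine ⟨((J.card : ℤ) - 2 * i).natAbs, by omega, ?_, ?_⟩
        · rw [Nat.cast_natAbs, Int.cast_abs, sq_abs]; push_cast; ring
        · rw [Int.natAbs_odd, Int.odd_sub]
          simp [parity_simps]
      simp only [Polynomial.eval_sub, Polynomial.eval_comp, Polynomial.eval_mul,
        Polynomial.eval_C, Polynomial.eval_pow, Polynomial.eval_X, hw2, hg w hwK, hodd, sub_self])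
  rw [map_sub, sub_eq_zero, Polynomial.aeval_comp, Polynomial.aeval_C] at hann
  rw [Polynomial.aeval_comp, map_pow, Polynomial.aeval_X, hsum]
  simp only [map_mul, map_pow, Polynomial.aeval_X, Polynomial.aeval_C] at hann
  rw [← Algebra.smul_def] at hann
  rw [hann]
  split_ifs <;> simp

open scoped Classical in
/-- A partition into independent cells whose sums lie in `L` can be chosen so that two members of
a cell have, modulo two, equally many neighbours in every cell. -/
theorem FrustrationFamily.exists_equitable [Fintype ι] (H : FrustrationFamily adj h)
    (L : LieSubalgebra ℝ A) (s₀ : Setoid ι)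
    (hind : ∀ x y, s₀ x y → ¬ adj x y)
    (hL : ∀ x, ∑ y with s₀ x y, h y ∈ L) :
    ∃ s : Setoid ι, s ≤ s₀ ∧ (∀ x, ∑ y with s x y, h y ∈ L) ∧
      ∀ x y z, s x y → (Odd (Finset.card {w | s z w ∧ adj x w}) ↔
        Odd (Finset.card {w | s z w ∧ adj y w})) := by
  have hfin : Finite (Setoid ι) :=
    Finite.of_injective (fun s : Setoid ι => (s : ι → ι → Prop)) fun s t hst =>
      Setoid.ext fun a b => iff_of_eq (congrFun (congrFun hst a) b)
  obtain ⟨s, ⟨hs₀, hsL⟩, hmin⟩ := Set.Finite.exists_minimal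
    (Set.toFinite {s : Setoid ι | s ≤ s₀ ∧ ∀ x, ∑ y with s x y, h y ∈ L}) ⟨s₀, le_rfl, hL⟩
  refine ⟨s, hs₀, hsL, fun x y z hxy => ?_⟩
  set par : ι → Prop := fun x => Odd (Finset.card {w | s z w ∧ adj x w}) with hpar
  have hodd : ∀ x, ∑ y with s x y ∧ par y, h y ∈ L := by
    intro x
    have := H.sum_odd_mem L {w | s z w} {y | s x y} (fun p hp q hq =>
      hind p q (hs₀ (s.trans' (s.symm' (by simpa using hp)) (by simpa using hq))))
      (hsL z) (hsL x)
    simpa only [Finset.filter_filter] using this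
  -- Splitting every cell by parity keeps the cell sums in `L`: the odd part by `sum_odd_mem`, the
  -- even part as a difference. Minimality of `s` therefore makes the parity constant on cells.
  have hle : s ≤ s ⊓ Setoid.ker par := by
    refine hmin ⟨inf_le_left.trans hs₀, fun x => ?_⟩ inf_le_left
    by_cases hx : par x
    · convert hodd x using 3 with y
      simp [Setoid.inf_def, Setoid.ker_def, hx]
    · have h1 := L.sub_mem (hsL x) (hodd x)
      rw [← Finset.filter_filter, ← Finset.sum_filter_add_sum_filter_not
        (Finset.univ.filter fun y => s x y) par, add_sub_cancel_left, Finset.filter_filter] at h1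
      convert h1 using 3 with y
      simp [Setoid.inf_def, Setoid.ker_def, hx]
  exact iff_of_eq ((Setoid.inf_iff_and.1 (hle hxy)).2)

end Abstract

/-- The vertices on the arms of a spider. -/
abbrev Arm {k : ℕ} (m : Fin k → ℕ) : Type := Σ j : Fin k, Fin (m j)

/-! ### Equitable partitions of the anticommutation graph -/

section Combinatorics

variable {k : ℕ} {m : Fin k → ℕ} {W : Type}

/-- The inner neighbour of an arm vertex, which is `root` for the innermost vertices. -/
def parent (emb : Arm m → W) (root : Option W) (q : Arm m) : Option W :=
  if q.2.val = 0 then root else some (emb ⟨q.1, ⟨q.2.val - 1, by omega⟩⟩)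

/-- The anticommutation relation between the mixer terms, indexed by `W`, and the edge terms,
indexed by the outer end of the edge. -/
def FrustAdj (emb : Arm m → W) (root : Option W) : W ⊕ Arm m → W ⊕ Arm m → Prop
  | Sum.inl w, Sum.inr q => w = emb q ∨ parent emb root q = some w
  | Sum.inr q, Sum.inl w => w = emb q ∨ parent emb root q = some w
  | _, _ => False

variable {emb : Arm m → W} {root : Option W}

theorem FrustAdj.symm {x y : W ⊕ Arm m} (h : FrustAdj emb root x y) : FrustAdj emb root y x := by
  rcases x with x | x <;> rcases y with y | y <;> exact h

theorem parent_zero {q : Arm m} (h : q.2.val = 0) : parent emb root q = root := if_pos h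

theorem parent_succ {j : Fin k} {r : ℕ} (h : r + 1 < m j) :
    parent emb root ⟨j, ⟨r + 1, h⟩⟩ = some (emb ⟨j, ⟨r, by omega⟩⟩) := by
  simp [parent]

theorem parent_eq_some_emb (hemb : Function.Injective emb) (hroot : ∀ q, root ≠ some (emb q))
    {q' : Arm m} {j : Fin k} {r : ℕ} {hr : r < m j}
    (h : parent emb root q' = some (emb ⟨j, ⟨r, hr⟩⟩)) :
    ∃ h : r + 1 < m j, q' = ⟨j, ⟨r + 1, h⟩⟩ := by
  obtain ⟨j', r', hr'⟩ := q'
  unfold parent at h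
  split_ifs at h with h0
  · exact absurd h (hroot _)
  · have := hemb (Option.some.inj h)
    simp only [Sigma.mk.injEq] at this
    obtain ⟨rfl, h2⟩ := this
    have h3 := congrArg Fin.val (eq_of_heq h2)
    simp only at h0 h3
    obtain rfl : r' = r + 1 := by omega
    exact ⟨hr', rfl⟩

theorem frustAdj_inr_iff (q : Arm m) (w : W ⊕ Arm m) : FrustAdj emb root (Sum.inr q) w ↔
    w = Sum.inl (emb q) ∨ ∃ u, parent emb root q = some u ∧ w = Sum.inl u := by
  rcases w with w | w <;> simp [FrustAdj]

theorem frustAdj_inl_iff (q : Arm m) (w : W ⊕ Arm m) (hemb : Function.Injective emb) :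
    FrustAdj emb root (Sum.inl (emb q)) w ↔
    w = Sum.inr q ∨ ∃ q', parent emb root q' = some (emb q) ∧ w = Sum.inr q' := by
  rcases w with w | w
  · simp [FrustAdj]
  · simp only [FrustAdj, hemb.eq_iff, Sum.inr.injEq]
    constructor
    · rintro (h | h)
      · exact Or.inl h.symm
      · exact Or.inr ⟨w, h, rfl⟩
    · rintro (h | ⟨q', h, rfl⟩)
      · exact Or.inl h.symm
      · exact Or.inr h

-- Arm terms have one certain neighbour `a` and at most one further neighbour, so the parity of a
-- count is an exclusive or.
open scoped Classical in
theorem odd_card_filter_or {α : Type*} [Fintype α] (P R R' : α → Prop) (a : α)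
    (hR : ∀ w, R w ↔ w = a ∨ R' w) (ha : ¬ R' a) (hsub : ∀ w w', R' w → R' w' → w = w') :
    Odd (Finset.card {w | P w ∧ R w}) ↔ Xor (P a) (∃ w, R' w ∧ P w) := by
  by_cases h : ∃ w, R' w ∧ P w
  · obtain ⟨b, hb, hPb⟩ := h
    have hab : a ≠ b := fun h => ha (h ▸ hb)
    have hR'' : ∀ w, R' w ↔ w = b := fun w => ⟨fun h => hsub _ _ h hb, fun h => h ▸ hb⟩
    by_cases hPa : P a
    · have : (Finset.univ.filter fun w => P w ∧ R w) = {a, b} := by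
        ext w; simp only [Finset.mem_filter_univ, Finset.mem_insert, Finset.mem_singleton, hR, hR'']
        constructor
        · exact fun h => h.2
        · rintro (rfl | rfl) <;> simp_all
      simp [this, Finset.card_pair hab, hPa, hR'', hPb, Xor]
    · have : (Finset.univ.filter fun w => P w ∧ R w) = {b} := by
        ext w; simp only [Finset.mem_filter_univ, Finset.mem_singleton, hR, hR'']
        constructor
        · rintro ⟨h, rfl | rfl⟩
          · exact absurd h hPa
          · rfl
        · rintro rfl; simp_all
      simp [this, hPa, hR'', hPb, Xor]
  · by_cases hPa : P a
    · have : (Finset.univ.filter fun w => P w ∧ R w) = {a} := by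
        ext w; simp only [Finset.mem_filter_univ, Finset.mem_singleton, hR]
        constructor
        · rintro ⟨h', rfl | h''⟩
          · rfl
          · exact absurd ⟨w, h'', h'⟩ h
        · rintro rfl; simp_all
      simp [this, hPa, h, Xor]
    · have : (Finset.univ.filter fun w => P w ∧ R w) = ∅ := by
        ext w; simp only [Finset.mem_filter_univ, Finset.notMem_empty, hR, iff_false]
        rintro ⟨h', rfl | h''⟩
        · exact hPa h'
        · exact h ⟨w, h'', h'⟩
      simp [this, hPa, h, Xor]

open scoped Classical in
/-- A partition in which any two members of a cell have, modulo two, equally many neighbours in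
every cell. -/
def Equitable {ι : Type*} [Fintype ι] (adj : ι → ι → Prop) (s : Setoid ι) : Prop :=
  ∀ x y z, s x y → (Odd (Finset.card {w | s z w ∧ adj x w}) ↔
        Odd (Finset.card {w | s z w ∧ adj y w}))

-- The number of neighbours in a one-element cell is `0` or `1`, so its parity decides adjacency.
open scoped Classical in
theorem Equitable.adj_of_singleton {ι : Type*} [Fintype ι] {adj : ι → ι → Prop} {s : Setoid ι}
    (hs : Equitable adj s) (hsym : ∀ x y, adj x y → adj y x) {x y y' : ι}
    (hx : ∀ y, s x y → y = x) (hxy : adj x y) (hy : s y y') : adj x y' := by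
  have h1 : Odd (Finset.card {w | s x w ∧ adj y w}) := by
    have : (Finset.univ.filter fun w => s x w ∧ adj y w) = {x} := by
      ext w
      simp only [Finset.mem_filter_univ, Finset.mem_singleton]
      constructor
      · exact fun h => hx w h.1
      · rintro rfl
        exact ⟨s.refl' _, hsym _ _ hxy⟩
    simp [this]
  have h2 := ((hs y y' x hy).1 h1).pos
  obtain ⟨w, hw⟩ := Finset.card_pos.1 h2
  simp only [Finset.mem_filter_univ] at hw
  exact hsym _ _ (hx w hw.1 ▸ hw.2)

variable [Fintype W] {s : Setoid (W ⊕ Arm m)}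

theorem odd_inr_iff (hroot : ∀ q, root ≠ some (emb q)) (hemb : Function.Injective emb)
    (q : Arm m) (z : W ⊕ Arm m) [DecidablePred fun w => s z w ∧ FrustAdj emb root (Sum.inr q) w] :
    Odd (Finset.card {w | s z w ∧ FrustAdj emb root (Sum.inr q) w}) ↔
      Xor (s z (Sum.inl (emb q))) (∃ u, parent emb root q = some u ∧ s z (Sum.inl u)) := by
  convert odd_card_filter_or (fun w => s z w) _ _ _ (frustAdj_inr_iff (emb := emb) (root := root) q)
    ?_ ?_ using 2
  · congr!
  · constructor
    · rintro ⟨u, h, h'⟩; exact ⟨_, ⟨u, h, rfl⟩, h'⟩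
    · rintro ⟨_, ⟨u, h, rfl⟩, h'⟩; exact ⟨u, h, h'⟩
  · rintro ⟨u, h, h'⟩
    obtain rfl := Sum.inl.inj h'
    obtain ⟨j, r, hr⟩ := q
    obtain ⟨h1, h2⟩ := parent_eq_some_emb hemb hroot h
    simp at h2
  · rintro _ _ ⟨u, h, rfl⟩ ⟨u', h', rfl⟩
    rw [Option.some.inj (h.symm.trans h')]

theorem odd_inl_iff (hroot : ∀ q, root ≠ some (emb q)) (hemb : Function.Injective emb)
    (q : Arm m) (z : W ⊕ Arm m)
    [DecidablePred fun w => s z w ∧ FrustAdj emb root (Sum.inl (emb q)) w] :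
    Odd (Finset.card {w | s z w ∧ FrustAdj emb root (Sum.inl (emb q)) w}) ↔
      Xor (s z (Sum.inr q)) (∃ q', parent emb root q' = some (emb q) ∧ s z (Sum.inr q')) := by
  obtain ⟨j, r, hr⟩ := q
  convert odd_card_filter_or (fun w => s z w) _ _ _
    (fun w => frustAdj_inl_iff (emb := emb) (root := root) ⟨j, r, hr⟩ w hemb) ?_ ?_ using 2
  · congr!
  · constructor
    · rintro ⟨u, h, h'⟩; exact ⟨_, ⟨u, h, rfl⟩, h'⟩
    · rintro ⟨_, ⟨u, h, rfl⟩, h'⟩; exact ⟨u, h, h'⟩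
  · rintro ⟨u, h, h'⟩
    obtain ⟨h1, rfl⟩ := parent_eq_some_emb hemb hroot h
    simp at h'
  · rintro _ _ ⟨u, h, rfl⟩ ⟨u', h', rfl⟩
    obtain ⟨h1, rfl⟩ := parent_eq_some_emb hemb hroot h
    obtain ⟨h1, rfl⟩ := parent_eq_some_emb hemb hroot h'
    rfl

theorem xor_left_cancel_iff {a b c : Prop} (h : Xor a b ↔ Xor a c) : b ↔ c := by
  simp only [xor_iff_not_iff] at h; tauto

theorem xor_right_cancel_iff {a b c : Prop} (h : Xor b a ↔ Xor c a) : b ↔ c := by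
  simp only [xor_iff_not_iff] at h; tauto

variable (hroot : ∀ q, root ≠ some (emb q)) (hemb : Function.Injective emb)
  (hs : Equitable (FrustAdj emb root) s)

include hroot hemb hs

/-- Induction outwards. Two equivalent terms have equivalent inner neighbours, or share the root at
the start, so these cancel in the exclusive or and the outer neighbours must match. In particular
the outer neighbour exists on the second arm. -/
theorem Equitable.lockstep {p q : Fin k} (hp : 0 < m p) (hq : 0 < m q)
    (h0 : s (Sum.inr ⟨p, ⟨0, hp⟩⟩) (Sum.inr ⟨q, ⟨0, hq⟩⟩)) (r : ℕ) (hr : r < m p) :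
    ∃ hr' : r < m q, s (Sum.inr ⟨p, ⟨r, hr⟩⟩) (Sum.inr ⟨q, ⟨r, hr'⟩⟩) ∧
      s (Sum.inl (emb ⟨p, ⟨r, hr⟩⟩)) (Sum.inl (emb ⟨q, ⟨r, hr'⟩⟩)) := by
  classical
  induction r with
  | zero =>
    refine ⟨hq, h0, ?_⟩
    have h := hs _ _ (Sum.inl (emb ⟨p, ⟨0, hr⟩⟩)) h0
    rw [odd_inr_iff hroot hemb, odd_inr_iff hroot hemb, parent_zero rfl, parent_zero rfl] at h
    exact (xor_right_cancel_iff h).1 (s.refl' _)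
  | succ r ih =>
    obtain ⟨hr', he, hX⟩ := ih (by omega)
    have h := hs _ _ (Sum.inr ⟨p, ⟨r + 1, hr⟩⟩) hX
    rw [odd_inl_iff hroot hemb, odd_inl_iff hroot hemb,
      show s (Sum.inr ⟨p, ⟨r + 1, hr⟩⟩) (Sum.inr ⟨q, ⟨r, hr'⟩⟩) ↔
        s (Sum.inr ⟨p, ⟨r + 1, hr⟩⟩) (Sum.inr ⟨p, ⟨r, by omega⟩⟩) from
        ⟨fun h => s.trans' h (s.symm' he), fun h => s.trans' h he⟩] at h
    obtain ⟨q', hq', hsq'⟩ := (xor_left_cancel_iff h).1 ⟨_, parent_succ hr, s.refl' _⟩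
    obtain ⟨hr1, rfl⟩ := parent_eq_some_emb hemb hroot hq'
    refine ⟨hr1, hsq', ?_⟩
    have h := hs _ _ (Sum.inl (emb ⟨p, ⟨r + 1, hr⟩⟩)) hsq'
    rw [odd_inr_iff hroot hemb, odd_inr_iff hroot hemb, parent_succ hr, parent_succ hr1] at h
    simp only [Option.some.injEq, exists_eq_left'] at h
    rw [show s (Sum.inl (emb ⟨p, ⟨r + 1, hr⟩⟩)) (Sum.inl (emb ⟨q, ⟨r, hr'⟩⟩)) ↔
        s (Sum.inl (emb ⟨p, ⟨r + 1, hr⟩⟩)) (Sum.inl (emb ⟨p, ⟨r, by omega⟩⟩)) from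
        ⟨fun h => s.trans' h (s.symm' hX), fun h => s.trans' h hX⟩] at h
    exact (xor_right_cancel_iff h).1 (s.refl' _)

theorem Equitable.arm_eq (hinj : Function.Injective m) {p q : Fin k} (hp : 0 < m p) (hq : 0 < m q)
    (h0 : s (Sum.inr ⟨p, ⟨0, hp⟩⟩) (Sum.inr ⟨q, ⟨0, hq⟩⟩)) : p = q := by
  obtain ⟨h1, -⟩ := hs.lockstep hroot hemb hp hq h0 (m p - 1) (by omega)
  obtain ⟨h2, -⟩ := hs.lockstep hroot hemb hq hp (s.symm' h0) (m q - 1) (by omega)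
  exact hinj (by omega)

/-- A term equivalent to the outer neighbour of an isolated term is also a neighbour of that
isolated term. The only alternative is the inner neighbour, which is already isolated. -/
theorem Equitable.singleton_of_innermost
    (hinner : ∀ p (hp : 0 < m p) y, s (Sum.inr ⟨p, ⟨0, hp⟩⟩) y → y = Sum.inr ⟨p, ⟨0, hp⟩⟩)
    (hrt : ∀ u, root = some u → ∀ y, s (Sum.inl u) y → y = Sum.inl u)
    (p : Fin k) (r : ℕ) (hr : r < m p) :
    (∀ y, s (Sum.inr ⟨p, ⟨r, hr⟩⟩) y → y = Sum.inr ⟨p, ⟨r, hr⟩⟩) ∧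
      (∀ y, s (Sum.inl (emb ⟨p, ⟨r, hr⟩⟩)) y → y = Sum.inl (emb ⟨p, ⟨r, hr⟩⟩)) := by
  have hstep : ∀ r (hr : r < m p),
      (∀ y, s (Sum.inr ⟨p, ⟨r, hr⟩⟩) y → y = Sum.inr ⟨p, ⟨r, hr⟩⟩) →
      (∀ u, parent emb root ⟨p, ⟨r, hr⟩⟩ = some u → ∀ y, s (Sum.inl u) y → y = Sum.inl u) →
      (∀ y, s (Sum.inl (emb ⟨p, ⟨r, hr⟩⟩)) y → y = Sum.inl (emb ⟨p, ⟨r, hr⟩⟩)) := by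
    intro r hr he hpar y hy
    have := hs.adj_of_singleton (fun _ _ => FrustAdj.symm) he
      ((frustAdj_inr_iff _ _).2 (Or.inl rfl)) hy
    rcases (frustAdj_inr_iff _ _).1 this with h | ⟨u, hu, rfl⟩
    · exact h
    · exact (hpar u hu _ (s.symm' hy)).symm
  induction r with
  | zero =>
    refine ⟨hinner p hr, hstep 0 hr (hinner p hr) fun u hu => ?_⟩
    rw [parent_zero rfl] at hu
    exact hrt u hu
  | succ r ih =>
    obtain ⟨he, hX⟩ := ih (by omega)
    have he' : ∀ y, s (Sum.inr ⟨p, ⟨r + 1, hr⟩⟩) y → y = Sum.inr ⟨p, ⟨r + 1, hr⟩⟩ := by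
      intro y hy
      have := hs.adj_of_singleton (fun _ _ => FrustAdj.symm) hX
        ((frustAdj_inl_iff _ _ hemb).2 (Or.inr ⟨_, parent_succ hr, rfl⟩)) hy
      rcases (frustAdj_inl_iff _ _ hemb).1 this with rfl | ⟨q', hq', rfl⟩
      · exact (he _ (s.symm' hy)).symm
      · obtain ⟨-, rfl⟩ := parent_eq_some_emb hemb hroot hq'
        rfl
    refine ⟨he', hstep _ hr he' fun u hu => ?_⟩
    rw [parent_succ hr] at hu
    obtain rfl := Option.some.inj hu
    exact hX

-- Without a root, an innermost edge term has a single neighbour `a`. An edge term further out has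
-- two neighbours `b` and `c`, and the parity conditions in the cells of `a`, `b` and `c` contradict
-- each other.
omit hroot in
theorem Equitable.innermost_of_root_none (hinj : Function.Injective m) (hrt : root = none)
    (hcol : ∀ x y, s x y → x.isLeft = y.isLeft) (p : Fin k) (hp : 0 < m p) (y : W ⊕ Arm m)
    (hy : s (Sum.inr ⟨p, ⟨0, hp⟩⟩) y) : y = Sum.inr ⟨p, ⟨0, hp⟩⟩ := by
  classical
  have hroot : ∀ q, root ≠ some (emb q) := by simp [hrt]
  have hc := hcol _ _ hy
  rcases y with y | ⟨q, _ | r, hr⟩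
  · simp at hc
  · obtain rfl := hs.arm_eq hroot hemb hinj hp hr hy
    rfl
  · exfalso
    have h := fun z => (odd_inr_iff hroot hemb _ z).symm.trans
      ((hs _ _ z hy).trans (odd_inr_iff hroot hemb _ z))
    simp only [parent_succ hr, parent_zero (q := ⟨p, ⟨0, hp⟩⟩) rfl, hrt,
      reduceCtorEq, false_and, exists_false, Option.some.injEq, exists_eq_left',
      xor_iff_not_iff, iff_false, not_not] at h
    generalize (Sum.inl (emb ⟨p, ⟨0, hp⟩⟩) : W ⊕ Arm m) = a at h
    generalize (Sum.inl (emb ⟨q, ⟨r + 1, hr⟩⟩) : W ⊕ Arm m) = b at h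
    generalize (Sum.inl (emb ⟨q, ⟨r, _⟩⟩) : W ⊕ Arm m) = c at h
    -- The cell of `a` contains exactly one of `b` and `c`, so these are inequivalent. The cells of
    -- `b` and of `c` then force both to be equivalent to `a`.
    have hbc : ¬ s b c := fun hbc => by
      have := h a
      have h2 : s a b ↔ s a c := ⟨fun h => s.trans' h hbc, fun h => s.trans' h (s.symm' hbc)⟩
      simp [h2] at this
    have hba : s b a := by
      rw [h b]
      simp [hbc]
    have hca : s c a := by
      rw [h c]
      simpa using fun h => hbc (s.symm' h)
    exact hbc (s.trans' hba (s.symm' hca))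

end Combinatorics

/-! ### Isolating the centre of the full spider -/

section Full

variable {k : ℕ} {m : Fin k → ℕ}

theorem frustAdj_none_iff (w : Option (Arm m) ⊕ Arm m) :
    FrustAdj some (some none) (Sum.inl none) w ↔
      ∃ j, ∃ h : 0 < m j, w = Sum.inr ⟨j, ⟨0, h⟩⟩ := by
  rcases w with w | ⟨j, r, hr⟩
  · simp [FrustAdj]
  · simp only [FrustAdj, parent, reduceCtorEq, false_or, Sum.inr.injEq]
    split_ifs with h
    · subst h
      simp only [true_iff]
      exact ⟨j, hr, rfl⟩
    · simp only [Option.some.injEq, reduceCtorEq, false_iff]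
      rintro ⟨j', h', heq⟩
      obtain ⟨rfl, h2⟩ := Sigma.mk.inj heq
      have := congrArg Fin.val (eq_of_heq h2)
      exact h this

/-- Every vertex other than the centre of the frustration graph has at most two neighbours. -/
theorem frustAdj_degree_le_two {y : Option (Arm m) ⊕ Arm m} (hy : y ≠ Sum.inl none) :
    ∃ a, ∃ R : Option (Arm m) ⊕ Arm m → Prop, (∀ w w', R w → R w' → w = w') ∧
      ∀ w, FrustAdj some (some none) y w → w = a ∨ R w := by
  have hinj : Function.Injective (some : Arm m → Option (Arm m)) := Option.some_injective _
  rcases y with (_ | q) | q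
  · exact absurd rfl hy
  · refine ⟨_, _, ?_, fun w h => (frustAdj_inl_iff q w hinj).1 h⟩
    rintro _ _ ⟨u, h, rfl⟩ ⟨u', h', rfl⟩
    obtain ⟨j, r, hr⟩ := q
    obtain ⟨h1, rfl⟩ := parent_eq_some_emb hinj (by simp) h
    obtain ⟨h1, rfl⟩ := parent_eq_some_emb hinj (by simp) h'
    rfl
  · refine ⟨_, _, ?_, fun w h => (frustAdj_inr_iff q w).1 h⟩
    rintro _ _ ⟨u, h, rfl⟩ ⟨u', h', rfl⟩
    rw [Option.some.inj (h.symm.trans h')]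

/-- The innermost edge terms lie in different cells by `arm_eq`, so the centre has exactly one
neighbour in each of their `k` cells. An equivalent vertex has a neighbour in each of them, hence at
least three neighbours, and only the centre can have that many. -/
theorem Equitable.centre_singleton (hk : 3 ≤ k) (hm : ∀ j, 1 ≤ m j) (hinj : Function.Injective m)
    {s : Setoid (Option (Arm m) ⊕ Arm m)} (hs : Equitable (FrustAdj some (some none)) s)
    (y : Option (Arm m) ⊕ Arm m) (hy : s (Sum.inl none) y) : y = Sum.inl none := by
  classical
  by_contra hne
  have hroot : ∀ q : Arm m, (some none : Option (Option (Arm m))) ≠ some (some q) := by simp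
  have key : ∀ j, ∃ w, s (Sum.inr ⟨j, ⟨0, hm j⟩⟩) w ∧ FrustAdj some (some none) y w := by
    intro j
    have h1 : Odd (Finset.card {w | s (Sum.inr ⟨j, ⟨0, hm j⟩⟩) w ∧
        FrustAdj some (some none) (Sum.inl none) w}) := by
      have : (Finset.univ.filter fun w => s (Sum.inr ⟨j, ⟨0, hm j⟩⟩) w ∧
        FrustAdj some (some none) (Sum.inl none) w) = {Sum.inr ⟨j, ⟨0, hm j⟩⟩} := by
        ext w
        simp only [Finset.mem_filter_univ, Finset.mem_singleton, frustAdj_none_iff]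
        constructor
        · rintro ⟨h, j', h', rfl⟩
          obtain rfl := hs.arm_eq hroot (Option.some_injective _) hinj _ _ h
          rfl
        · rintro rfl
          exact ⟨s.refl' _, j, hm j, rfl⟩
      simp [this]
    obtain ⟨w, hw⟩ := Finset.card_pos.1 ((hs _ _ _ hy).1 h1).pos
    exact ⟨w, by simpa using hw⟩
  choose w hw hadj using key
  have hwinj : Function.Injective w := fun i j hij =>
    hs.arm_eq hroot (Option.some_injective _) hinj (hm i) (hm j)
      (s.trans' (hw i) (hij ▸ s.symm' (hw j)))
  obtain ⟨a, R, hR, hor⟩ := frustAdj_degree_le_two hne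
  have h01 : (⟨0, by omega⟩ : Fin k) ≠ ⟨1, by omega⟩ := by simp
  have h02 : (⟨0, by omega⟩ : Fin k) ≠ ⟨2, by omega⟩ := by simp
  have h12 : (⟨1, by omega⟩ : Fin k) ≠ ⟨2, by omega⟩ := by simp
  have hpair : ∀ i j, i ≠ j → (w i = a ∧ R (w j)) ∨ (w j = a ∧ R (w i)) := by
    intro i j hij
    rcases hor _ (hadj i) with h | h <;> rcases hor _ (hadj j) with h' | h'
    · exact absurd (hwinj (h.trans h'.symm)) hij
    · exact Or.inl ⟨h, h'⟩
    · exact Or.inr ⟨h', h⟩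
    · exact absurd (hwinj (hR _ _ h h')) hij
  rcases hpair _ _ h01 with ⟨ha, hb⟩ | ⟨ha, hb⟩
  · rcases hpair _ _ h12 with ⟨hc, hd⟩ | ⟨hc, hd⟩
    · exact h01 (hwinj (ha.trans hc.symm))
    · exact h02 (hwinj (ha.trans hc.symm))
  · rcases hpair _ _ h02 with ⟨hc, hd⟩ | ⟨hc, hd⟩
    · exact h01 (hwinj (hc.trans ha.symm))
    · exact h12 (hwinj (ha.trans hc.symm))

end Full

/-! ### Pauli strings and the terms of the Hamiltonians -/

section Pauli

variable {W : Type} [Fintype W] [DecidableEq W]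

/-- The product of the Pauli operators `X_w` over the `w` with `R w = true`. -/
def xString (R : W → Bool) : Op W :=
  Matrix.of fun x y => if x = (fun w => R w ^^ y w) then 1 else 0

omit [DecidableEq W] in
theorem xString_apply (R x y : W → Bool) :
    xString R x y = if x = (fun w => R w ^^ y w) then 1 else 0 := rfl

theorem pauliX_eq_xString (w : W) : pauliX w = xString fun u => decide (u = w) := by
  ext x y
  simp only [pauliX, xString, Matrix.of_apply]
  congr 2
  funext u
  by_cases h : u = w
  · subst h; simp
  · simp [h]

theorem xString_mul (R S : W → Bool) : xString R * xString S = xString fun w => R w ^^ S w := by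
  ext x y
  simp only [Matrix.mul_apply, xString_apply, mul_ite, mul_one, mul_zero]
  rw [Finset.sum_ite_eq_of_mem' _ _ _ (Finset.mem_univ _)]
  simp

omit [DecidableEq W] in
theorem xString_false : xString (fun _ : W => false) = 1 := by
  ext x y
  simp [xString_apply, Matrix.one_apply]

theorem xString_mul_pauliZ (R : W → Bool) (w : W) :
    xString R * pauliZ w = (if R w then -1 else 1 : ℂ) • (pauliZ w * xString R) := by
  ext x y
  rw [pauliZ, Matrix.mul_diagonal, Matrix.smul_apply, Matrix.diagonal_mul, xString_apply]
  split_ifs with h h1 h2 h3 h3 h3 <;> simp_all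

theorem xString_commute (R S : W → Bool) : Commute (xString R) (xString S) := by
  simp only [Commute, SemiconjBy, xString_mul, Bool.xor_comm]

theorem xString_mul_self (R : W → Bool) : xString R * xString R = 1 := by
  simp [xString_mul, xString_false]

theorem pauliZ_mul_self (w : W) : pauliZ w * pauliZ w = 1 := by
  rw [pauliZ, Matrix.diagonal_mul_diagonal, ← Matrix.diagonal_one]
  congr 1
  funext x
  split_ifs <;> norm_num

/-- The operator `Z_w` for a vertex `w`, and the identity for no vertex. -/
def pauliZOpt : Option W → Op W
  | none => 1
  | some w => pauliZ w

theorem pauliZOpt_mul_self (o : Option W) : pauliZOpt o * pauliZOpt o = 1 := by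
  cases o
  · simp [pauliZOpt]
  · exact pauliZ_mul_self _

theorem pauliZOpt_commute (o : Option W) (w : W) : Commute (pauliZOpt o) (pauliZ w) := by
  cases o
  · exact Commute.one_left _
  · exact pauliZ_mul_comm _ _

theorem pauliZOpt_commute_pauliZOpt (o o' : Option W) : Commute (pauliZOpt o) (pauliZOpt o') := by
  cases o'
  · exact Commute.one_right _
  · exact pauliZOpt_commute _ _

theorem xString_mul_pauliZOpt (R : W → Bool) (o : Option W) :
    xString R * pauliZOpt o =
      (if ∃ w, o = some w ∧ R w then -1 else 1 : ℂ) • (pauliZOpt o * xString R) := by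
  cases o
  · simp [pauliZOpt]
  · simp [pauliZOpt, xString_mul_pauliZ]

variable {k : ℕ} {m : Fin k → ℕ}

/-- The individual mixer terms and edge terms. -/
def frustGen (emb : Arm m → W) (root : Option W) : W ⊕ Arm m → Op W
  | Sum.inl w => Complex.I • pauliX w
  | Sum.inr q => Complex.I • (pauliZOpt (parent emb root q) * pauliZ (emb q))

variable {emb : Arm m → W} {root : Option W}

omit [Fintype W] [DecidableEq W] in
theorem parent_ne_some_emb (hroot : ∀ q, root ≠ some (emb q)) (hemb : Function.Injective emb)
    (q : Arm m) : parent emb root q ≠ some (emb q) := by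
  intro h
  obtain ⟨j, r, hr⟩ := q
  obtain ⟨h1, h2⟩ := parent_eq_some_emb hemb hroot h
  simp at h2

open scoped Classical in
theorem xString_mul_frustGen_inr (R : W → Bool) (q : Arm m) :
    xString R * frustGen emb root (Sum.inr q) =
      ((if ∃ w, parent emb root q = some w ∧ R w then -1 else 1) *
        (if R (emb q) then -1 else 1) : ℂ) • (frustGen emb root (Sum.inr q) * xString R) := by
  have h1 := xString_mul_pauliZOpt R (parent emb root q)
  have h2 := xString_mul_pauliZ R (emb q)
  rw [frustGen, mul_smul_comm, ← mul_assoc, h1, smul_mul_assoc, mul_assoc, h2, mul_smul_comm,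
    smul_mul_assoc, smul_smul, smul_smul, smul_smul, mul_assoc]
  congr 1
  · rw [mul_comm, mul_assoc]
  · rw [mul_assoc]

theorem frustrationFamily_frustGen (hroot : ∀ q, root ≠ some (emb q))
    (hemb : Function.Injective emb) :
    FrustrationFamily (FrustAdj emb root) (frustGen emb root) := by
  classical
  have key : ∀ w q, frustGen emb root (Sum.inl w) * frustGen emb root (Sum.inr q) =
      (if FrustAdj emb root (Sum.inl w) (Sum.inr q) then -1 else 1 : ℂ) •
        (frustGen emb root (Sum.inr q) * frustGen emb root (Sum.inl w)) := by
    intro w q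
    simp only [FrustAdj]
    have h1 := xString_mul_frustGen_inr (emb := emb) (root := root) (fun u => decide (u = w)) q
    have h2 : frustGen emb root (Sum.inl w : W ⊕ Arm m) =
      Complex.I • xString fun u => decide (u = w) := by rw [← pauliX_eq_xString]; rfl
    rw [h2, smul_mul_assoc, h1, mul_smul_comm, smul_comm]
    congr 1
    have h3 := parent_ne_some_emb hroot hemb q
    by_cases h4 : w = emb q
    · subst h4
      simp [h3]
    · simp [h4, Ne.symm h4]
  refine ⟨fun x y => FrustAdj.symm, ?_, ?_, ?_⟩
  · rintro (w | q)
    · simp [frustGen, pauliX_eq_xString, xString_mul_self, smul_smul]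
    · simp only [frustGen, smul_mul_smul_comm, Complex.I_mul_I]
      rw [(pauliZOpt_commute (parent emb root q) (emb q)).symm.mul_mul_mul_comm, pauliZOpt_mul_self, pauliZ_mul_self]
      simp
  · rintro (w | q) (w' | q') h
    · exact h.elim
    · rw [key, if_pos h, neg_one_smul]
    · rw [key, if_pos h.symm, neg_one_smul, neg_neg]
    · exact h.elim
  · rintro (w | q) (w' | q') h
    · simp only [frustGen, pauliX_eq_xString]
      exact ((xString_commute _ _).smul_left _).smul_right _
    · have := key w q'
      rw [if_neg h, one_smul] at this
      exact this
    · have := key w' q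
      rw [if_neg fun h' => h h'.symm, one_smul] at this
      exact this.symm
    · refine (Commute.smul_left ?_ _).smul_right _
      exact ((pauliZOpt_commute_pauliZOpt _ _).mul_right (pauliZOpt_commute _ _)).mul_left
        ((pauliZOpt_commute _ _).symm.mul_right (pauliZ_mul_comm _ _))

theorem sum_frustGen_inl : ∑ w : W, frustGen emb root (Sum.inl w : W ⊕ Arm m) =
    Complex.I • mixer W := by
  simp [frustGen, mixer, Finset.smul_sum]

/-- An edge is determined by its outer end. A vertex with `parent` equal to `none` carries a single
`Z` operator instead of an edge. -/
theorem sum_edgeFinset_pauliZZ (hroot : ∀ q, root ≠ some (emb q)) (hemb : Function.Injective emb)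
    (G : SimpleGraph W) [DecidableRel G.Adj]
    (hG : ∀ a b, G.Adj a b ↔ ∃ q, (parent emb root q = some a ∧ b = emb q) ∨
      (parent emb root q = some b ∧ a = emb q)) :
    ∑ e ∈ G.edgeFinset, pauliZZ e =
      ∑ q with parent emb root q ≠ none, pauliZOpt (parent emb root q) * pauliZ (emb q) := by
  symm
  refine Finset.sum_nbij (fun q => s((parent emb root q).getD (emb q), emb q)) ?_ ?_ ?_ ?_
  · intro q hq
    obtain ⟨a, ha⟩ := Option.ne_none_iff_exists'.1 (Finset.mem_filter.1 hq).2
    rw [SimpleGraph.mem_edgeFinset, SimpleGraph.mem_edgeSet, hG]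
    exact ⟨q, Or.inl ⟨by simp [ha], rfl⟩⟩
  · intro q hq q' hq' h
    obtain ⟨a, ha⟩ := Option.ne_none_iff_exists'.1 (Finset.mem_filter.1 hq).2
    obtain ⟨a', ha'⟩ := Option.ne_none_iff_exists'.1 (Finset.mem_filter.1 hq').2
    simp only [ha, ha', Option.getD_some, Sym2.eq_iff] at h
    rcases h with h | ⟨rfl, rfl⟩
    · exact hemb h.2
    -- Two arm vertices cannot each be the parent of the other: the positions would satisfy `r = r'
    -- + 1` and `r' = r + 1`.
    · obtain ⟨j, r, hr⟩ := q
      obtain ⟨j', r', hr'⟩ := q'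
      obtain ⟨h1, h2⟩ := parent_eq_some_emb hemb hroot ha
      obtain ⟨h3, h4⟩ := parent_eq_some_emb hemb hroot ha'
      obtain ⟨rfl, h6⟩ := Sigma.mk.inj h2
      have h7 := congrArg Fin.val (eq_of_heq h6)
      have h8 := congrArg Fin.val (eq_of_heq (Sigma.mk.inj h4).2)
      simp only at h7 h8
      omega
  · intro e he
    induction e using Sym2.ind with
    | _ a b =>
      rw [Finset.mem_coe, SimpleGraph.mem_edgeFinset, SimpleGraph.mem_edgeSet, hG] at he
      obtain ⟨q, ⟨h1, rfl⟩ | ⟨h1, rfl⟩⟩ := he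
      · exact ⟨q, by simp [h1], by simp [h1]⟩
      · exact ⟨q, by simp [h1], by simp [h1, Sym2.eq_swap]⟩
  · intro q hq
    obtain ⟨a, ha⟩ := Option.ne_none_iff_exists'.1 (Finset.mem_filter.1 hq).2
    simp [ha, pauliZOpt, pauliZZ]

end Pauli

/-! ### From equitable partitions to individual terms -/

section Generation

variable {k : ℕ} {m : Fin k → ℕ} {W : Type} [Fintype W] {emb : Arm m → W} {root : Option W}
  {A : Type*} [Ring A] [Algebra ℂ A] [Algebra ℝ A]

theorem FrustrationFamily.exists_equitable_sum {h : W ⊕ Arm m → A}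
    (H : FrustrationFamily (FrustAdj emb root) h) (L : LieSubalgebra ℝ A)
    (hX : ∑ w, h (Sum.inl w) ∈ L) (hZ : ∑ q, h (Sum.inr q) ∈ L) :
    ∃ s : Setoid (W ⊕ Arm m), (∀ x y, s x y → x.isLeft = y.isLeft) ∧
      (∀ x, (∀ y, s x y → y = x) → h x ∈ L) ∧ Equitable (FrustAdj emb root) s := by
  classical
  have hind : ∀ x y, Setoid.ker (Sum.isLeft : W ⊕ Arm m → Bool) x y →
      ¬ FrustAdj emb root x y := by
    rintro (x | x) (y | y) h1
    · exact id
    · simp [Setoid.ker_def] at h1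
    · simp [Setoid.ker_def] at h1
    · exact id
  have hsum : ∀ x, ∑ y with Setoid.ker (Sum.isLeft : W ⊕ Arm m → Bool) x y, h y ∈ L := by
    rintro (x | x)
    · convert hX using 1
      rw [Finset.sum_filter, Fintype.sum_sum_type]
      simp [Setoid.ker_def]
    · convert hZ using 1
      rw [Finset.sum_filter, Fintype.sum_sum_type]
      simp [Setoid.ker_def]
  obtain ⟨s, hs₀, hsL, hs⟩ := H.exists_equitable L (Setoid.ker Sum.isLeft) hind
    (fun x => by convert hsum x)
  refine ⟨s, fun x y hxy => hs₀ hxy, fun x hx => ?_, fun x y z hxy => ?_⟩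
  · have h2 := hsL x
    have h3 : ∑ y with s x y, h y = h x := by
      convert Finset.sum_singleton h x using 2
      ext y
      simp only [Finset.mem_filter_univ, Finset.mem_singleton]
      constructor
      · exact hx y
      · rintro rfl
        exact s.refl' _
    rwa [← h3]
  · convert hs x y z hxy using 2

theorem FrustrationFamily.mem_of_root_none (hinj : Function.Injective m)
    (hemb : Function.Bijective emb) {h : W ⊕ Arm m → A}
    (H : FrustrationFamily (FrustAdj emb none) h) (L : LieSubalgebra ℝ A)
    (hX : ∑ w, h (Sum.inl w) ∈ L) (hZ : ∑ q, h (Sum.inr q) ∈ L) (x : W ⊕ Arm m) : h x ∈ L := by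
  obtain ⟨s, hcol, hsL, hs⟩ := H.exists_equitable_sum L hX hZ
  have key := hs.singleton_of_innermost (by simp) hemb.1
    (hs.innermost_of_root_none hemb.1 hinj rfl hcol) (by simp)
  rcases x with w | ⟨j, r, hr⟩
  · obtain ⟨⟨j, r, hr⟩, rfl⟩ := hemb.2 w
    exact hsL _ (key j r hr).2
  · exact hsL _ (key j r hr).1

theorem FrustrationFamily.mem_of_centre (hk : 3 ≤ k) (hm : ∀ j, 1 ≤ m j)
    (hinj : Function.Injective m) {h : Option (Arm m) ⊕ Arm m → A}
    (H : FrustrationFamily (FrustAdj some (some none)) h) (L : LieSubalgebra ℝ A)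
    (hX : ∑ w, h (Sum.inl w) ∈ L) (hZ : ∑ q, h (Sum.inr q) ∈ L) (x : Option (Arm m) ⊕ Arm m) :
    h x ∈ L := by
  obtain ⟨s, -, hsL, hs⟩ := H.exists_equitable_sum L hX hZ
  have hc := hs.centre_singleton hk hm hinj
  have key := hs.singleton_of_innermost (by simp) (Option.some_injective _) (fun p hp y hy => by
      have := hs.adj_of_singleton (fun _ _ => FrustAdj.symm) hc
        ((frustAdj_none_iff _).2 ⟨p, hp, rfl⟩) hy
      obtain ⟨q, hq, rfl⟩ := (frustAdj_none_iff _).1 this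
      obtain rfl := hs.arm_eq (by simp) (Option.some_injective _) hinj hp hq hy
      rfl)
    (by rintro u hu; obtain rfl := Option.some.inj hu; exact hc)
  rcases x with (_ | ⟨j, r, hr⟩) | ⟨j, r, hr⟩
  · exact hsL _ hc
  · exact hsL _ (key j r hr).2
  · exact hsL _ (key j r hr).1

end Generation

/-! ### The spider and its reduced graph -/

section Spider

variable {k : ℕ} {m : Fin k → ℕ}

theorem spiderStep_iff (a b : SpiderVertex m) :
    SpiderStep m a b ↔ ∃ q, parent some (some none) q = some a ∧ b = some q := by
  rcases b with _ | ⟨j, r, hr⟩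
  · cases a <;> simp [SpiderStep]
  · simp only [Option.some.injEq, exists_eq_right']
    rcases a with _ | ⟨j', r', hr'⟩
    · simp [SpiderStep, parent]
    · simp only [SpiderStep]
      constructor
      · rintro ⟨rfl, h⟩
        subst h
        exact parent_succ hr
      · intro h
        obtain ⟨h1, h2⟩ := parent_eq_some_emb (Option.some_injective _) (by simp) h
        obtain ⟨rfl, h3⟩ := Sigma.mk.inj h2
        have := congrArg Fin.val (eq_of_heq h3)
        exact ⟨rfl, this.symm⟩

theorem spider_adj_iff (a b : SpiderVertex m) :
    (spider m).Adj a b ↔ ∃ q, (parent some (some none) q = some a ∧ b = some q) ∨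
      (parent some (some none) q = some b ∧ a = some q) := by
  rw [spider, SimpleGraph.fromRel_adj, spiderStep_iff, spiderStep_iff, exists_or]
  refine ⟨fun h => h.2, fun h => ⟨?_, h⟩⟩
  rintro rfl
  rw [or_self] at h
  obtain ⟨q, h1, rfl⟩ := h
  exact parent_ne_some_emb (by simp) (Option.some_injective _) q h1

theorem sum_frustGen_inr_spider :
    ∑ q, frustGen some (some none) (Sum.inr q : SpiderVertex m ⊕ Arm m) =
      Complex.I • problem (spider m) := by
  rw [problem, sum_edgeFinset_pauliZZ (by simp) (Option.some_injective _) _ spider_adj_iff,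
    Finset.smul_sum, Finset.filter_true_of_mem]
  · rfl
  · intro q _
    unfold parent
    split_ifs <;> simp

theorem frustGen_mem_stdDLA (hk : 3 ≤ k) (hm : ∀ j, 1 ≤ m j) (hinj : Function.Injective m)
    (x : SpiderVertex m ⊕ Arm m) : frustGen some (some none) x ∈ stdDLA (spider m) := by
  refine (frustrationFamily_frustGen (by simp) (Option.some_injective _)).mem_of_centre hk hm hinj
    _ ?_ ?_ x
  · rw [sum_frustGen_inl]
    exact LieSubalgebra.subset_lieSpan (by simp)
  · rw [sum_frustGen_inr_spider]
    exact LieSubalgebra.subset_lieSpan (by simp)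

/-- The arm vertices as vertices of the reduced spider. -/
def armRest (q : Arm m) : Rest (spiderCentre m) := ⟨some q, by simp⟩

theorem armRest_bijective : Function.Bijective (armRest (m := m)) := by
  constructor
  · intro p q h
    exact Option.some.inj (congrArg Subtype.val h)
  · rintro ⟨_ | q, h⟩
    · exact absurd rfl h
    · exact ⟨q, rfl⟩

theorem parent_armRest_eq_some_iff (q : Arm m) (w : Rest (spiderCentre m)) :
    parent armRest none q = some w ↔ parent some (some none) q = some w.val := by
  obtain ⟨p, rfl⟩ := armRest_bijective.2 w
  unfold parent
  split_ifs
  · simp [armRest]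
  · simp [armRest]

theorem reduced_adj_iff (a b : Rest (spiderCentre m)) :
    (reducedGraph (spider m) (spiderCentre m)).Adj a b ↔
      ∃ q, (parent armRest none q = some a ∧ b = armRest q) ∨
      (parent armRest none q = some b ∧ a = armRest q) := by
  simp only [SimpleGraph.comap_adj, spider_adj_iff, parent_armRest_eq_some_iff, Subtype.ext_iff,
    armRest]

theorem spider_adj_centre_iff (q : Arm m) :
    (spider m).Adj (spiderCentre m) (armRest q).val ↔ parent armRest none q = none := by
  rw [spider_adj_iff]
  simp only [armRest, reduceCtorEq, and_false, or_false, Option.some.injEq, exists_eq_right']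
  unfold parent
  split_ifs <;> simp

theorem sum_frustGen_inr_reduced :
    ∑ q, frustGen armRest none (Sum.inr q : Rest (spiderCentre m) ⊕ Arm m) =
      Complex.I • reducedProblem (spider m) (spiderCentre m) := by
  rw [reducedProblem, sum_edgeFinset_pauliZZ (by simp) armRest_bijective.1 _ reduced_adj_iff]
  have : ∑ w : Rest (spiderCentre m) with (spider m).Adj (spiderCentre m) w.val, pauliZ w =
      ∑ q with ¬ parent (m := m) armRest none q ≠ none,
        pauliZOpt (parent armRest none q) * pauliZ (armRest q) := by
    symm
    refine Finset.sum_bijective armRest armRest_bijective (fun q => ?_) (fun q hq => ?_)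
    · simp [← spider_adj_centre_iff]
    · simp only [ne_eq, not_not, Finset.mem_filter_univ] at hq
      simp [hq, pauliZOpt]
  rw [this, Finset.sum_filter_add_sum_filter_not, Finset.smul_sum]
  rfl

theorem reducedFreeDLA_spider : reducedFreeDLA (spider m) (spiderCentre m) =
    LieSubalgebra.lieSpan ℝ _ (Set.range (frustGen (m := m) armRest none)) := by
  rw [reducedFreeDLA]
  congr 1
  ext A
  constructor
  · rintro ((⟨w, rfl⟩ | ⟨e, he, rfl⟩) | ⟨w, hw, rfl⟩)
    · exact ⟨Sum.inl w, rfl⟩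
    · induction e using Sym2.ind with
      | _ a b =>
        rw [SimpleGraph.mem_edgeSet, reduced_adj_iff] at he
        obtain ⟨q, ⟨h1, rfl⟩ | ⟨h1, rfl⟩⟩ := he
        · exact ⟨Sum.inr q, by simp [frustGen, h1, pauliZOpt, pauliZZ]⟩
        · exact ⟨Sum.inr q, by simp [frustGen, h1, pauliZOpt, pauliZZ, pauliZ_mul_comm]⟩
    · obtain ⟨q, rfl⟩ := armRest_bijective.2 w
      rw [spider_adj_centre_iff] at hw
      exact ⟨Sum.inr q, by simp [frustGen, hw, pauliZOpt]⟩
  · rintro ⟨w | q, rfl⟩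
    · exact Or.inl (Or.inl ⟨w, rfl⟩)
    · rcases h : parent armRest none q with _ | a
      · exact Or.inr ⟨armRest q, (spider_adj_centre_iff q).2 h, by simp [frustGen, h, pauliZOpt]⟩
      · refine Or.inl (Or.inr ⟨s(a, armRest q), ?_, by simp [frustGen, h, pauliZOpt, pauliZZ]⟩)
        rw [SimpleGraph.mem_edgeSet, reduced_adj_iff]
        exact ⟨q, Or.inl ⟨h, rfl⟩⟩

theorem reducedStdDLA_eq_reducedFreeDLA (hinj : Function.Injective m) :
    reducedStdDLA (spider m) (spiderCentre m) = reducedFreeDLA (spider m) (spiderCentre m) := by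
  rw [reducedFreeDLA_spider]
  apply le_antisymm
  · rw [reducedStdDLA, LieSubalgebra.lieSpan_le, ← sum_frustGen_inr_reduced,
      ← sum_frustGen_inl (emb := armRest (m := m)) (root := none)]
    rintro _ (rfl | rfl)
    · exact sum_mem fun w _ => LieSubalgebra.subset_lieSpan ⟨_, rfl⟩
    · exact sum_mem fun w _ => LieSubalgebra.subset_lieSpan ⟨_, rfl⟩
  · rw [LieSubalgebra.lieSpan_le]
    rintro _ ⟨x, rfl⟩
    refine (frustrationFamily_frustGen (by simp) armRest_bijective.1).mem_of_root_none hinj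
      armRest_bijective _ ?_ ?_ x
    · rw [sum_frustGen_inl]
      exact LieSubalgebra.subset_lieSpan (by simp)
    · rw [sum_frustGen_inr_reduced]
      exact LieSubalgebra.subset_lieSpan (by simp)

end Spider

/-! ### Clifford families, Majorana operators and the spin representation -/

section Clifford

variable {A : Type*} [Ring A] [Algebra ℝ A]

/-- Pairwise anticommuting involutions. -/
structure CliffordFamily {n : ℕ} (γ : Fin n → A) : Prop where
  sq : ∀ a, γ a * γ a = 1
  anti : ∀ a b, a ≠ b → γ a * γ b = -(γ b * γ a)

variable {n : ℕ} {γ : Fin n → A}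

theorem CliffordFamily.mul_eq (H : CliffordFamily γ) (a b : Fin n) :
    γ a * γ b = (if a = b then (2 : ℝ) else 0) • 1 - γ b * γ a := by
  split_ifs with h
  · subst h
    rw [H.sq, two_smul]; abel
  · rw [H.anti a b h]; simp

/-- The quadratic element of a Clifford algebra attached to a matrix. -/
def spinMap (γ : Fin n → A) : Matrix (Fin n) (Fin n) ℝ →ₗ[ℝ] A where
  toFun M := (1 / 4 : ℝ) • ∑ a, ∑ b, M a b • (γ a * γ b)
  map_add' M N := by simp [add_smul, Finset.sum_add_distrib]
  map_smul' c M := by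
    simp only [Matrix.smul_apply, smul_eq_mul, mul_smul, ← Finset.smul_sum, RingHom.id_apply]
    rw [smul_comm]

theorem spinMap_apply (M : Matrix (Fin n) (Fin n) ℝ) :
    spinMap γ M = (1 / 4 : ℝ) • ∑ a, ∑ b, M a b • (γ a * γ b) := rfl

/-- The factor `1 / 4` in `spinMap` is chosen so that a skew matrix acts on the span of the `γ a` by
that very matrix. This gives both the bracket relation and injectivity. -/
theorem CliffordFamily.lie_spinMap (H : CliffordFamily γ) {M : Matrix (Fin n) (Fin n) ℝ}
    (hM : M.transpose = -M) (c : Fin n) : ⁅spinMap γ M, γ c⁆ = ∑ a, M a c • γ a := by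
  have hskew : ∀ a b, M a b = -M b a := fun a b => congrFun (congrFun hM b) a
  have h1 : ∀ a b, γ a * γ b * γ c - γ c * (γ a * γ b) =
      (if b = c then (2 : ℝ) else 0) • γ a - (if a = c then (2 : ℝ) else 0) • γ b := by
    intro a b
    rw [mul_assoc, H.mul_eq b c, mul_sub, ← mul_assoc (γ a), H.mul_eq a c, sub_mul]
    simp only [mul_smul_comm, smul_mul_assoc, mul_one, one_mul, mul_assoc]
    abel
  rw [spinMap_apply, Ring.lie_def, smul_mul_assoc, mul_smul_comm, ← smul_sub]
  simp only [Finset.sum_mul, Finset.mul_sum, smul_mul_assoc, mul_smul_comm,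
    ← Finset.sum_sub_distrib, ← smul_sub, h1]
  simp only [smul_sub, Finset.sum_sub_distrib, ite_smul, zero_smul, smul_ite, smul_zero,
    Finset.sum_ite_eq', Finset.mem_univ, if_true]
  rw [Finset.sum_comm (f := fun a b => if a = c then M a b • (2 : ℝ) • γ b else 0)]
  simp only [Finset.sum_ite_eq', Finset.mem_univ, if_true]
  rw [← smul_sub, ← Finset.sum_sub_distrib, Finset.smul_sum]
  refine Finset.sum_congr rfl fun a _ => ?_
  rw [hskew c a]
  module

/-- Bracketing with `spinMap γ M` is a derivation, so on the products `γ c * γ d` it changes the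
coefficient matrix `N` to `M * N + N * Mᵀ`, which is the commutator for skew `M`. -/
theorem CliffordFamily.spinMap_lie (H : CliffordFamily γ) {M N : Matrix (Fin n) (Fin n) ℝ}
    (hM : M.transpose = -M) :
    spinMap γ ⁅M, N⁆ = ⁅spinMap γ M, spinMap γ N⁆ := by
  have hskew : ∀ a b, M a b = -M b a := fun a b => congrFun (congrFun hM b) a
  have h1 : ∀ c d, ⁅spinMap γ M, γ c * γ d⁆ =
      ∑ a, M a c • (γ a * γ d) + ∑ a, M a d • (γ c * γ a) := by
    intro c d
    have : ⁅spinMap γ M, γ c * γ d⁆ = ⁅spinMap γ M, γ c⁆ * γ d + γ c * ⁅spinMap γ M, γ d⁆ := by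
      simp only [Ring.lie_def]; noncomm_ring
    rw [this, H.lie_spinMap hM, H.lie_spinMap hM, Finset.sum_mul, Finset.mul_sum]
    simp only [smul_mul_assoc, mul_smul_comm]
  rw [spinMap_apply N, lie_smul, spinMap_apply]
  congr 1
  have h2 : ⁅spinMap γ M, ∑ c, ∑ d, N c d • (γ c * γ d)⁆ =
      ∑ c, ∑ d, (∑ a, (N c d * M a c) • (γ a * γ d) + ∑ a, (N c d * M a d) • (γ c * γ a)) := by
    simp only [lie_sum, lie_smul, h1, smul_add, Finset.smul_sum, smul_smul]
  rw [h2]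
  simp only [Finset.sum_add_distrib, Ring.lie_def, Matrix.sub_apply, Matrix.mul_apply, sub_smul,
    Finset.sum_smul, Finset.sum_sub_distrib]
  rw [sub_eq_add_neg]
  congr 1
  · refine (Finset.sum_congr rfl fun a _ => Finset.sum_comm).trans (Finset.sum_comm.trans
      (Finset.sum_congr rfl fun c _ => Finset.sum_comm.trans (Finset.sum_congr rfl fun d _ =>
        Finset.sum_congr rfl fun a _ => ?_)))
    rw [mul_comm]
  · simp only [← Finset.sum_neg_distrib]
    refine Finset.sum_congr rfl fun c _ => ?_
    rw [Finset.sum_comm]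
    refine Finset.sum_congr rfl fun d _ => Finset.sum_congr rfl fun a _ => ?_
    rw [hskew d a, ← neg_smul]
    congr 1
    ring

/-- The spin representation of `so(n)` defined by a Clifford family. -/
def CliffordFamily.spinHom (H : CliffordFamily γ) :
    LieAlgebra.Orthogonal.so (Fin n) ℝ →ₗ⁅ℝ⁆ A where
  toLinearMap := spinMap γ ∘ₗ (LieAlgebra.Orthogonal.so (Fin n) ℝ).toSubmodule.subtype
  map_lie' := by
    intro M N
    exact H.spinMap_lie ((LieAlgebra.Orthogonal.mem_so _ _ _).1 M.2)

theorem CliffordFamily.spinHom_apply (H : CliffordFamily γ)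
    (M : LieAlgebra.Orthogonal.so (Fin n) ℝ) : H.spinHom M = spinMap γ M.val := rfl

/-- The anticommutator with `γ d` extracts twice the coefficient of `γ d`. -/
theorem CliffordFamily.eq_zero_of_sum [Nontrivial A] (H : CliffordFamily γ) (v : Fin n → ℝ)
    (hv : ∑ a, v a • γ a = 0) (d : Fin n) : v d = 0 := by
  have h1 : ∑ a, v a • (γ a * γ d + γ d * γ a) = 0 := by
    have := congrArg₂ (· + ·) (congrArg (· * γ d) hv) (congrArg (γ d * ·) hv)
    simpa [Finset.sum_mul, Finset.mul_sum, ← Finset.sum_add_distrib] using this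
  simp only [H.mul_eq _ d, sub_add_cancel, ite_smul, zero_smul, smul_ite, smul_zero,
    Finset.sum_ite_eq', Finset.mem_univ, if_true, smul_smul] at h1
  rcases smul_eq_zero.1 h1 with h | h
  · linarith
  · exact absurd h one_ne_zero

/-- The products `Ξ g₀ ⋯ gₙ₋₁`. -/
def majorana (Ξ : A) (g : ℕ → A) : ℕ → A
  | 0 => Ξ
  | n + 1 => majorana Ξ g n * g n

/-- A chain of square roots of `-1`, anticommuting exactly when consecutive, together with an
involution that anticommutes with the first of them only. -/
structure MajoranaChain (Ξ : A) (g : ℕ → A) (N : ℕ) : Prop where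
  root_sq : Ξ * Ξ = 1
  root_anti : 0 < N → Ξ * g 0 = -(g 0 * Ξ)
  root_comm : ∀ i, i < N → 0 < i → Commute Ξ (g i)
  sq : ∀ i, i < N → g i * g i = -1
  anti : ∀ i, i + 1 < N → g i * g (i + 1) = -(g (i + 1) * g i)
  comm : ∀ i j, i + 1 < j → j < N → Commute (g i) (g j)

variable {Ξ : A} {g : ℕ → A} {N : ℕ}

omit [Algebra ℝ A] in
theorem MajoranaChain.majorana_mul (H : MajoranaChain Ξ g N) (a i : ℕ) (ha : a ≤ N) (hi : i < N) :
    (i = a ∨ i + 1 = a → majorana Ξ g a * g i = -(g i * majorana Ξ g a)) ∧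
      (¬ (i = a ∨ i + 1 = a) → Commute (majorana Ξ g a) (g i)) := by
  induction a with
  | zero =>
    constructor
    · rintro (rfl | h)
      · exact H.root_anti hi
      · omega
    · intro h
      exact H.root_comm i hi (by omega)
  | succ a ih =>
    obtain ⟨ih1, ih2⟩ := ih (by omega)
    have hanti : ∀ {x y z : A}, x * z = -(z * x) → Commute y z → x * y * z = -(z * (x * y)) := by
      intro x y z h1 h2
      rw [mul_assoc, h2.eq, ← mul_assoc, h1, neg_mul, mul_assoc]
    have hanti' : ∀ {x y z : A}, Commute x z → y * z = -(z * y) → x * y * z = -(z * (x * y)) := by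
      intro x y z h1 h2
      rw [mul_assoc, h2, mul_neg, ← mul_assoc, h1.eq, mul_assoc]
    simp only [majorana]
    constructor
    · rintro (rfl | h)
      · exact hanti' (ih2 (by omega)) (H.anti a hi)
      · obtain rfl : i = a := by omega
        exact hanti (ih1 (Or.inl rfl)) (Commute.refl _)
    · intro h
      rcases lt_trichotomy (i + 1) a with h1 | h1 | h1
      · exact (ih2 (by omega)).mul_left (H.comm i a h1 (by omega)).symm
      · subst h1
        have h2 := ih1 (Or.inr rfl)
        have h3 := H.anti i (by omega)
        show _ * _ = _ * _
        rw [mul_assoc, ← neg_eq_iff_eq_neg.2 h3, mul_neg, ← mul_assoc, h2, neg_mul, neg_neg,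
          mul_assoc]
      · exact (ih2 (by omega)).mul_left (H.comm a i (by omega) hi)

omit [Algebra ℝ A] in
theorem MajoranaChain.majorana_sq (H : MajoranaChain Ξ g N) (a : ℕ) (ha : a ≤ N) :
    majorana Ξ g a * majorana Ξ g a = 1 := by
  induction a with
  | zero => exact H.root_sq
  | succ a ih =>
    simp only [majorana]
    have h1 := (H.majorana_mul a a (by omega) (by omega)).1 (Or.inl rfl)
    rw [mul_assoc, ← mul_assoc (g a), ← neg_eq_iff_eq_neg.2 h1, neg_mul, mul_assoc,
      H.sq a (by omega)]
    simp [ih (by omega)]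

omit [Algebra ℝ A] in
theorem MajoranaChain.majorana_anti (H : MajoranaChain Ξ g N) (a b : ℕ) (hab : a < b) (hb : b ≤ N) :
    majorana Ξ g a * majorana Ξ g b = -(majorana Ξ g b * majorana Ξ g a) := by
  induction b with
  | zero => omega
  | succ b ih =>
    simp only [majorana]
    rcases Nat.lt_succ_iff_lt_or_eq.1 hab with h | rfl
    · rw [← mul_assoc, ih h (by omega), neg_mul, mul_assoc,
        ((H.majorana_mul a b (by omega) (by omega)).2 (by omega)).eq, ← mul_assoc]
    · rw [mul_assoc _ (g a), ← neg_eq_iff_eq_neg.2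
        ((H.majorana_mul a a (by omega) (by omega)).1 (Or.inl rfl)), mul_neg, neg_neg]

omit [Algebra ℝ A] in
theorem MajoranaChain.cliffordFamily (H : MajoranaChain Ξ g N) :
    CliffordFamily fun a : Fin (N + 1) => majorana Ξ g a where
  sq a := H.majorana_sq a (by omega)
  anti a b hab := by
    rcases lt_or_gt_of_ne hab with h | h
    · exact H.majorana_anti a b h (by omega)
    · rw [H.majorana_anti b a h (by omega), neg_neg]

omit [Algebra ℝ A] in
theorem MajoranaChain.majorana_mul_succ (H : MajoranaChain Ξ g N) (a : ℕ) (ha : a < N) :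
    majorana Ξ g a * majorana Ξ g (a + 1) = g a := by
  simp only [majorana]
  rw [← mul_assoc, H.majorana_sq a (by omega), one_mul]

/-- Consecutive Majorana operators multiply to a generator, and bracketing with the next generator
extends the product by one position. -/
theorem MajoranaChain.mul_mem (H : MajoranaChain Ξ g N) (L : LieSubalgebra ℝ A)
    (hL : ∀ i < N, g i ∈ L) (a b : ℕ) (hab : a < b) (hb : b ≤ N) :
    majorana Ξ g a * majorana Ξ g b ∈ L := by
  induction b with
  | zero => omega
  | succ b ih =>
    rcases Nat.lt_succ_iff_lt_or_eq.1 hab with h | rfl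
    · have h1 := L.lie_mem (ih h (by omega)) (hL b (by omega))
      have h2 : ⁅majorana Ξ g a * majorana Ξ g b, g b⁆ =
          (2 : ℝ) • (majorana Ξ g a * majorana Ξ g (b + 1)) := by
        simp only [majorana]
        rw [Ring.lie_def, ← mul_assoc (g b),
          ← ((H.majorana_mul a b (by omega) (by omega)).2 (by omega)).eq, mul_assoc, mul_assoc,
          ← neg_eq_iff_eq_neg.2 ((H.majorana_mul b b (by omega) (by omega)).1 (Or.inl rfl)),
          mul_neg, sub_neg_eq_add, two_smul]
      rw [h2] at h1
      simpa [smul_smul] using L.smul_mem (1 / 2 : ℝ) h1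
    · rw [H.majorana_mul_succ a (by omega)]
      exact hL a (by omega)

theorem MajoranaChain.spinHom_mem (H : MajoranaChain Ξ g N) (L : LieSubalgebra ℝ A)
    (hL : ∀ i < N, g i ∈ L) (M : LieAlgebra.Orthogonal.so (Fin (N + 1)) ℝ) :
    H.cliffordFamily.spinHom M ∈ L := by
  rw [CliffordFamily.spinHom_apply, spinMap_apply]
  refine L.smul_mem _ (sum_mem fun a _ => sum_mem fun b _ => ?_)
  rcases lt_trichotomy a b with h | rfl | h
  · exact L.smul_mem _ (H.mul_mem L hL a b h (by omega))
  · have hskew := congrFun (congrFun ((LieAlgebra.Orthogonal.mem_so _ _ _).1 M.2) a) a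
    simp only [Matrix.transpose_apply, Matrix.neg_apply] at hskew
    rw [show M.val a a = 0 by linarith, zero_smul]
    exact L.zero_mem
  · rw [H.cliffordFamily.anti a b h.ne']
    exact L.smul_mem _ (neg_mem (H.mul_mem L hL b a h (by omega)))

theorem MajoranaChain.mem_range_spinHom (H : MajoranaChain Ξ g N) (i : ℕ) (hi : i < N) :
    ∃ M, H.cliffordFamily.spinHom M = g i := by
  set a : Fin (N + 1) := ⟨i, by omega⟩ with ha
  set b : Fin (N + 1) := ⟨i + 1, by omega⟩ with hb
  have hab : a ≠ b := by simp [ha, hb]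
  -- The factor `2` and the antisymmetrisation cancel the `1 / 4` of `spinMap`, leaving `γ a * γ b =
  -- g i`.
  refine ⟨⟨(2 : ℝ) • (Matrix.single a b 1 - Matrix.single b a 1), ?_⟩, ?_⟩
  · rw [LieAlgebra.Orthogonal.mem_so]
    simp [Matrix.transpose_sub, ← smul_neg]
  · have hsingle : ∀ c d : Fin (N + 1), spinMap (fun a : Fin (N + 1) => majorana Ξ g a)
        (Matrix.single c d 1) = (1 / 4 : ℝ) • (majorana Ξ g c * majorana Ξ g d) := by
      intro c d
      rw [spinMap_apply, Finset.sum_eq_single c, Finset.sum_eq_single d]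
      · simp
      · intro x _ hx; simp [Matrix.single, Ne.symm hx]
      · simp
      · intro x _ hx; simp [Matrix.single, Ne.symm hx]
      · simp
    rw [CliffordFamily.spinHom_apply, map_smul, map_sub, hsingle, hsingle,
      H.cliffordFamily.anti b a hab.symm]
    have := H.majorana_mul_succ i hi
    simp only [ha, hb, this]
    module

omit [Algebra ℝ A] in
theorem commute_majorana {x : A} (hΞ : Commute x Ξ) (n : ℕ) (hg : ∀ i < n, Commute x (g i)) :
    Commute x (majorana Ξ g n) := by
  induction n with
  | zero => exact hΞ
  | succ n ih => exact (ih fun i hi => hg i (by omega)).mul_right (hg n (by omega))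

theorem spinMap_commute {n' : ℕ} {γ' : Fin n' → A} (h : ∀ a b, Commute (γ a) (γ' b))
    (M : Matrix (Fin n) (Fin n) ℝ) (b : Fin n') : Commute (spinMap γ M) (γ' b) := by
  rw [spinMap_apply]
  exact (Commute.sum_left _ _ _ fun a _ => Commute.sum_left _ _ _ fun c _ =>
    ((h a b).mul_left (h c b)).smul_left _).smul_left _

theorem spinMap_commute_spinMap {n' : ℕ} {γ' : Fin n' → A} (h : ∀ a b, Commute (γ a) (γ' b))
    (M : Matrix (Fin n) (Fin n) ℝ) (M' : Matrix (Fin n') (Fin n') ℝ) :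
    Commute (spinMap γ M) (spinMap γ' M') := by
  rw [spinMap_apply M']
  exact (Commute.sum_right _ _ _ fun a _ => Commute.sum_right _ _ _ fun c _ =>
    ((spinMap_commute h M a).mul_right (spinMap_commute h M c)).smul_right _).smul_right _

/-- Coordinates on the skew-symmetric matrices. -/
def soEquiv (n : ℕ) : LieAlgebra.Orthogonal.so (Fin n) ℝ ≃ₗ[ℝ] ((Σ b : Fin n, Fin b) → ℝ) where
  toFun M p := M.val (p.2.castLE p.1.is_lt.le) p.1
  map_add' _ _ := rfl
  map_smul' _ _ := rfl
  invFun f := ⟨Matrix.of fun a b => if h : a < b then f ⟨b, ⟨a, h⟩⟩ else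
    if h : b < a then -f ⟨a, ⟨b, h⟩⟩ else 0, by
      rw [LieAlgebra.Orthogonal.mem_so]
      ext a b
      rcases lt_trichotomy a b with h | rfl | h
      · simp [h, h.not_gt]
      · simp
      · simp [h, h.not_gt]⟩
  left_inv M := by
    have hskew : ∀ a b, M.val a b = -M.val b a := fun a b =>
      congrFun (congrFun ((LieAlgebra.Orthogonal.mem_so _ _ _).1 M.2) b) a
    apply Subtype.ext
    ext a b
    rcases lt_trichotomy a b with h | rfl | h
    · simp [h]
    · have := hskew a a
      simp only [Matrix.of_apply, lt_self_iff_false, dite_false]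
      linarith
    · simp only [Matrix.of_apply, h.not_gt, h, dite_true, dite_false]
      rw [hskew a b]
      rfl
  right_inv f := by
    funext ⟨b, a⟩
    have h : a.castLE b.is_lt.le < b := a.is_lt
    simp [h]

theorem finrank_so (n : ℕ) :
    Module.finrank ℝ (LieAlgebra.Orthogonal.so (Fin n) ℝ) * 2 = n * (n - 1) := by
  rw [(soEquiv n).finrank_eq, Module.finrank_fintype_fun_eq_card, Fintype.card_sigma]
  simp only [Fintype.card_fin]
  rw [Fin.sum_univ_eq_sum_range (fun i => i), Finset.sum_range_id_mul_two]

end Clifford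

/-! ### The spin representation carried by the arms -/

section Arms

variable {k : ℕ} {m : Fin k → ℕ} {W : Type} [Fintype W] [DecidableEq W]

/-- The terms on one arm in the order in which they are met from the centre. -/
def armGen (emb : Arm m → W) (root : Option W) (j : Fin k) (n : ℕ) : Op W :=
  if h : n / 2 < m j then
    if n % 2 = 0 then frustGen emb root (Sum.inr ⟨j, ⟨n / 2, h⟩⟩)
    else frustGen emb root (Sum.inl (emb ⟨j, ⟨n / 2, h⟩⟩))
  else 1

open scoped Classical in
/-- The product of the Pauli operators `X_w` over the `j`-th arm. -/
def armParity (emb : Arm m → W) (j : Fin k) : Op W :=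
  xString fun w => decide (∃ r, w = emb ⟨j, r⟩)

variable {emb : Arm m → W} {root : Option W}

theorem armGen_even (j : Fin k) (r : ℕ) (hr : r < m j) :
    armGen emb root j (2 * r) = frustGen emb root (Sum.inr ⟨j, ⟨r, hr⟩⟩) := by
  have h : 2 * r / 2 = r := by omega
  simp [armGen, h, hr]

theorem armGen_odd (j : Fin k) (r : ℕ) (hr : r < m j) :
    armGen emb root j (2 * r + 1) = frustGen emb root (Sum.inl (emb ⟨j, ⟨r, hr⟩⟩)) := by
  have h : (2 * r + 1) / 2 = r := by omega
  have h' : ¬ (2 * r + 1) % 2 = 0 := by omega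
  rw [armGen, dif_pos (by omega), if_neg h']
  simp only [h]

theorem exists_armGen_eq (j : Fin k) (n : ℕ) (hn : n < 2 * m j) :
    ∃ x, armGen emb root j n = frustGen emb root x := by
  rw [armGen, dif_pos (by omega)]
  split_ifs <;> exact ⟨_, rfl⟩

omit [Fintype W] [DecidableEq W] in
theorem frustAdj_inr_emb_iff (hroot : ∀ q, root ≠ some (emb q)) (hemb : Function.Injective emb)
    (i j : Fin k) (r s : ℕ) (hr : r < m i) (hs : s < m j) :
    FrustAdj emb root (Sum.inr ⟨i, ⟨r, hr⟩⟩) (Sum.inl (emb ⟨j, ⟨s, hs⟩⟩)) ↔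
      i = j ∧ (r = s ∨ r = s + 1) := by
  simp only [FrustAdj, hemb.eq_iff]
  constructor
  · rintro (h | h)
    · obtain ⟨rfl, h2⟩ := Sigma.mk.inj h
      exact ⟨rfl, Or.inl (congrArg Fin.val (eq_of_heq h2)).symm⟩
    · obtain ⟨h1, h2⟩ := parent_eq_some_emb hemb hroot h
      obtain ⟨rfl, h3⟩ := Sigma.mk.inj h2
      exact ⟨rfl, Or.inr (congrArg Fin.val (eq_of_heq h3))⟩
  · rintro ⟨rfl, rfl | rfl⟩
    · exact Or.inl rfl
    · exact Or.inr (parent_succ hr)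

theorem armParity_commute_inl (j : Fin k) (w : W) :
    Commute (armParity emb j) (frustGen emb root (Sum.inl w : W ⊕ Arm m)) := by
  rw [frustGen, pauliX_eq_xString]
  exact (xString_commute _ _).smul_right _

/-- Flipping the whole arm changes the sign of a product of two `Z` operators only if exactly one of
them sits on the arm, which happens at the innermost term alone. -/
theorem armParity_mul_inr (hroot : ∀ q, root ≠ some (emb q)) (hemb : Function.Injective emb)
    (i j : Fin k) (r : ℕ) (hr : r < m i) :
    armParity emb j * frustGen emb root (Sum.inr ⟨i, ⟨r, hr⟩⟩) =
      (if i = j ∧ r = 0 then -1 else 1 : ℂ) •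
        (frustGen emb root (Sum.inr ⟨i, ⟨r, hr⟩⟩) * armParity emb j) := by
  classical
  rw [armParity, xString_mul_frustGen_inr]
  congr 1
  have h1 : (∃ r', emb ⟨i, ⟨r, hr⟩⟩ = emb ⟨j, r'⟩) ↔ i = j := by
    constructor
    · rintro ⟨r', h⟩
      exact (Sigma.mk.inj (hemb h)).1
    · rintro rfl
      exact ⟨_, rfl⟩
  have h2 : (∃ w, parent emb root ⟨i, ⟨r, hr⟩⟩ = some w ∧ ∃ r', w = emb ⟨j, r'⟩) ↔
      i = j ∧ r ≠ 0 := by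
    constructor
    · rintro ⟨w, hw, ⟨r', hr'⟩, rfl⟩
      obtain ⟨h3, h4⟩ := parent_eq_some_emb hemb hroot hw
      obtain ⟨rfl, h5⟩ := Sigma.mk.inj h4
      have := congrArg Fin.val (eq_of_heq h5)
      simp only at this
      exact ⟨rfl, by omega⟩
    · rintro ⟨rfl, h⟩
      obtain ⟨r, rfl⟩ := Nat.exists_eq_succ_of_ne_zero h
      exact ⟨_, parent_succ hr, _, rfl⟩
  simp only [decide_eq_true_eq, h1, h2]
  by_cases hij : i = j <;> by_cases hr0 : r = 0 <;> simp [hij, hr0]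

theorem majoranaChain_armGen (hroot : ∀ q, root ≠ some (emb q)) (hemb : Function.Injective emb)
    (j : Fin k) : MajoranaChain (armParity emb j) (armGen emb root j) (2 * m j) := by
  have H := frustrationFamily_frustGen hroot hemb
  refine ⟨xString_mul_self _, fun h => ?_, fun i hi hi0 => ?_, fun i hi => ?_, fun i hi => ?_,
    fun i i' hii' hi' => ?_⟩
  · rw [show (0 : ℕ) = 2 * 0 from rfl, armGen_even j 0 (by omega), armParity_mul_inr hroot hemb]
    simp
  · obtain ⟨r, rfl | rfl⟩ := Nat.even_or_odd' i
    · rw [armGen_even j r (by omega)]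
      have := armParity_mul_inr hroot hemb j j r (by omega)
      rw [if_neg (by omega), one_smul] at this
      exact this
    · rw [armGen_odd j r (by omega)]
      exact armParity_commute_inl _ _
  · obtain ⟨x, hx⟩ := exists_armGen_eq (emb := emb) (root := root) j i hi
    rw [hx, H.sq]
  · obtain ⟨r, rfl | rfl⟩ := Nat.even_or_odd' i
    · rw [armGen_even j r (by omega), armGen_odd j r (by omega)]
      exact H.anti _ _ ((frustAdj_inr_emb_iff hroot hemb _ _ _ _ _ _).2 ⟨rfl, Or.inl rfl⟩)
    · rw [show 2 * r + 1 + 1 = 2 * (r + 1) by ring, armGen_even j (r + 1) (by omega),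
        armGen_odd j r (by omega)]
      exact H.anti _ _ ((frustAdj_inr_emb_iff hroot hemb _ _ _ _ _ _).2 ⟨rfl, Or.inr rfl⟩).symm
  · obtain ⟨r, rfl | rfl⟩ := Nat.even_or_odd' i <;> obtain ⟨s, rfl | rfl⟩ := Nat.even_or_odd' i'
    · rw [armGen_even j r (by omega), armGen_even j s (by omega)]
      exact H.comm _ _ id
    · rw [armGen_even j r (by omega), armGen_odd j s (by omega)]
      refine H.comm _ _ fun h => ?_
      rw [frustAdj_inr_emb_iff hroot hemb] at h
      omega
    · rw [armGen_odd j r (by omega), armGen_even j s (by omega)]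
      refine H.comm _ _ fun h => ?_
      have h := h.symm
      rw [frustAdj_inr_emb_iff hroot hemb] at h
      omega
    · rw [armGen_odd j r (by omega), armGen_odd j s (by omega)]
      exact H.comm _ _ id

theorem armGen_commute_armGen (hroot : ∀ q, root ≠ some (emb q)) (hemb : Function.Injective emb)
    {i j : Fin k} (hij : i ≠ j) (n n' : ℕ) (hn : n < 2 * m i) (hn' : n' < 2 * m j) :
    Commute (armGen emb root i n) (armGen emb root j n') := by
  have H := frustrationFamily_frustGen hroot hemb
  obtain ⟨r, rfl | rfl⟩ := Nat.even_or_odd' n <;> obtain ⟨s, rfl | rfl⟩ := Nat.even_or_odd' n'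
  · rw [armGen_even i r (by omega), armGen_even j s (by omega)]
    exact H.comm _ _ id
  · rw [armGen_even i r (by omega), armGen_odd j s (by omega)]
    refine H.comm _ _ fun h => ?_
    rw [frustAdj_inr_emb_iff hroot hemb] at h
    exact hij h.1
  · rw [armGen_odd i r (by omega), armGen_even j s (by omega)]
    refine H.comm _ _ fun h => ?_
    have h := h.symm
    rw [frustAdj_inr_emb_iff hroot hemb] at h
    exact hij h.1.symm
  · rw [armGen_odd i r (by omega), armGen_odd j s (by omega)]
    exact H.comm _ _ id

theorem armParity_commute_armGen (hroot : ∀ q, root ≠ some (emb q)) (hemb : Function.Injective emb)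
    {i j : Fin k} (hij : i ≠ j) (n : ℕ) (hn : n < 2 * m i) :
    Commute (armParity emb j) (armGen emb root i n) := by
  obtain ⟨r, rfl | rfl⟩ := Nat.even_or_odd' n
  · rw [armGen_even i r (by omega)]
    have := armParity_mul_inr hroot hemb i j r (by omega)
    rw [if_neg fun h => hij h.1, one_smul] at this
    exact this
  · rw [armGen_odd i r (by omega)]
    exact armParity_commute_inl _ _

theorem majorana_commute (hroot : ∀ q, root ≠ some (emb q)) (hemb : Function.Injective emb)
    {i j : Fin k} (hij : i ≠ j) (n n' : ℕ) (hn : n ≤ 2 * m i) (hn' : n' ≤ 2 * m j) :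
    Commute (majorana (armParity emb i) (armGen emb root i) n)
      (majorana (armParity emb j) (armGen emb root j) n') := by
  refine commute_majorana (commute_majorana (xString_commute _ _) n fun l hl =>
    armParity_commute_armGen hroot hemb hij l (by omega)).symm n' fun l hl => ?_
  exact (commute_majorana (armParity_commute_armGen hroot hemb hij.symm l (by omega)).symm n
    fun l' hl' => (armGen_commute_armGen hroot hemb hij _ _ (by omega) (by omega)).symm).symm

variable (emb root) in
/-- The Majorana operators on the `j`-th arm. -/
def armMajorana (j : Fin k) (a : Fin (2 * m j + 1)) : Op W :=
  majorana (armParity emb j) (armGen emb root j) a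

theorem cliffordFamily_armMajorana (hroot : ∀ q, root ≠ some (emb q))
    (hemb : Function.Injective emb) (j : Fin k) : CliffordFamily (armMajorana emb root j) :=
  (majoranaChain_armGen hroot hemb j).cliffordFamily

theorem armMajorana_commute (hroot : ∀ q, root ≠ some (emb q))
    (hemb : Function.Injective emb) {i j : Fin k} (hij : i ≠ j) (a : Fin (2 * m i + 1))
    (b : Fin (2 * m j + 1)) : Commute (armMajorana emb root i a) (armMajorana emb root j b) :=
  majorana_commute hroot hemb hij a b (by omega) (by omega)

theorem armSpin_lie (hroot : ∀ q, root ≠ some (emb q))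
    (hemb : Function.Injective emb) : Pairwise fun i j : Fin k => ∀ x y,
      ⁅(cliffordFamily_armMajorana hroot hemb i).spinHom x,
        (cliffordFamily_armMajorana hroot hemb j).spinHom y⁆ = 0 := by
  intro i j hij x y
  rw [CliffordFamily.spinHom_apply, CliffordFamily.spinHom_apply]
  exact (spinMap_commute_spinMap (armMajorana_commute hroot hemb hij) _ _).lie_eq

variable (hroot : ∀ q, root ≠ some (emb q)) (hemb : Function.Injective emb)

/-- The joint spin representation of the arms. -/
def armHom : (⨁ j : Fin k, LieAlgebra.Orthogonal.so (Fin (2 * m j + 1)) ℝ) →ₗ⁅ℝ⁆ Op W :=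
  DirectSum.toLieAlgebra (Op W) (fun j => (cliffordFamily_armMajorana hroot hemb j).spinHom)
    (armSpin_lie hroot hemb)

theorem armHom_of (j : Fin k) (M : LieAlgebra.Orthogonal.so (Fin (2 * m j + 1)) ℝ) :
    armHom hroot hemb (DirectSum.lof ℝ _ _ j M) =
      (cliffordFamily_armMajorana hroot hemb j).spinHom M :=
  DirectSum.toModule_lof _ _ _

theorem armHom_apply (x : ⨁ j : Fin k, LieAlgebra.Orthogonal.so (Fin (2 * m j + 1)) ℝ) :
    armHom hroot hemb x = ∑ j, spinMap (armMajorana emb root j) (x j).val := by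
  conv_lhs => rw [← DirectSum.sum_univ_of x]
  rw [map_sum]
  exact Finset.sum_congr rfl fun j _ => armHom_of hroot hemb j (x j)

/-- The Majorana operators of different arms commute, so bracketing with `armMajorana emb root j c`
kills the other summands and leaves column `c` of the `j`-th matrix as coefficients. -/
theorem armHom_injective : Function.Injective (armHom hroot hemb) := by
  rw [injective_iff_map_eq_zero]
  intro x hx
  rw [armHom_apply] at hx
  ext j : 1
  apply Subtype.ext
  ext a c
  have H := cliffordFamily_armMajorana hroot hemb j
  refine H.eq_zero_of_sum (fun a => (x j).val a c) ?_ a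
  rw [← H.lie_spinMap ((LieAlgebra.Orthogonal.mem_so _ _ _).1 (x j).2) c]
  have h1 := congrArg (fun y => ⁅y, armMajorana emb root j c⁆) hx
  simp only [zero_lie, sum_lie] at h1
  refine Eq.trans (Eq.symm ?_) h1
  refine Finset.sum_eq_single j (fun i _ hij => ?_) fun h => absurd (Finset.mem_univ j) h
  exact (spinMap_commute (armMajorana_commute hroot hemb hij) _ _).lie_eq

theorem range_armHom (hsurj : Function.Surjective emb) :
    (armHom hroot hemb).range = LieSubalgebra.lieSpan ℝ _ (Set.range (frustGen emb root)) := by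
  apply le_antisymm
  · rintro _ ⟨x, rfl⟩
    rw [LieHom.coe_toLinearMap, armHom_apply]
    refine sum_mem fun j _ => (majoranaChain_armGen hroot hemb j).spinHom_mem _ (fun i hi => ?_) _
    obtain ⟨y, hy⟩ := exists_armGen_eq (emb := emb) (root := root) j i hi
    rw [hy]
    exact LieSubalgebra.subset_lieSpan ⟨y, rfl⟩
  · rw [LieSubalgebra.lieSpan_le]
    have key : ∀ j n, n < 2 * m j → armGen emb root j n ∈ (armHom hroot hemb).range := by
      intro j n hn
      obtain ⟨M, hM⟩ := (majoranaChain_armGen hroot hemb j).mem_range_spinHom n hn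
      exact ⟨DirectSum.lof ℝ _ _ j M, (armHom_of hroot hemb j M).trans hM⟩
    rintro _ ⟨w | ⟨j, r, hr⟩, rfl⟩
    · obtain ⟨⟨j, r, hr⟩, rfl⟩ := hsurj w
      rw [← armGen_odd]
      exact key j _ (by omega)
    · rw [← armGen_even]
      exact key j _ (by omega)

end Arms

/-! ### Structure and dimension of the reduced algebra -/

section Reduced

variable {k : ℕ} {m : Fin k → ℕ}

/-- The free reduced dynamical Lie algebra of a spider is a sum of orthogonal Lie algebras. -/
def reducedFreeDLAEquiv (m : Fin k → ℕ) : reducedFreeDLA (spider m) (spiderCentre m) ≃ₗ⁅ℝ⁆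
    (⨁ j : Fin k, LieAlgebra.Orthogonal.so (Fin (2 * m j + 1)) ℝ) :=
  (LieEquiv.ofEq _ _ (congrArg _ (reducedFreeDLA_spider.trans
    (range_armHom (root := none) (by simp) armRest_bijective.1 armRest_bijective.2).symm))).trans
    (LieEquiv.ofInjective _ (armHom_injective (root := none) (by simp) armRest_bijective.1)).symm

theorem finrank_reducedFreeDLA (m : Fin k → ℕ) :
    Module.finrank ℝ (reducedFreeDLA (spider m) (spiderCentre m)) =
      2 * ∑ j, m j ^ 2 + ∑ j, m j := by
  have hfin : ∀ j, Module.Finite ℝ (LieAlgebra.Orthogonal.so (Fin (2 * m j + 1)) ℝ) :=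
    fun j => Module.Finite.equiv (soEquiv _).symm
  rw [(reducedFreeDLAEquiv m).toLinearEquiv.finrank_eq, Module.finrank_directSum, Finset.mul_sum,
    ← Finset.sum_add_distrib]
  refine Finset.sum_congr rfl fun j _ => ?_
  have := finrank_so (2 * m j + 1)
  rw [Nat.add_sub_cancel] at this
  nlinarith

theorem sum_sq_le_sq_sum (m : Fin k → ℕ) : ∑ j, m j ^ 2 ≤ (∑ j, m j) ^ 2 := by
  rw [sq, Finset.sum_mul]
  refine Finset.sum_le_sum fun j _ => ?_
  rw [sq]
  exact Nat.mul_le_mul_left _ (Finset.single_le_sum (fun _ _ => Nat.zero_le _) (Finset.mem_univ j))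

end Reduced

/-! ### Commutator identities for exponential growth -/

section Growth

variable {A : Type*} [Ring A] [Algebra ℝ A]

/-- A commuting factor `M` is carried along the chain, since `⁅g n, ⁅g (n + 1), M * g n⁆⁆ = 4 • (M *
g (n + 1))`. -/
theorem MajoranaChain.mul_mem_of_commute {Ξ : A} {g : ℕ → A} {N : ℕ} (H : MajoranaChain Ξ g N)
    (L : LieSubalgebra ℝ A) (hL : ∀ i < N, g i ∈ L) {M : A} (hM : ∀ i < N, Commute M (g i))
    (h0 : M * g 0 ∈ L) (n : ℕ) (hn : n < N) : M * g n ∈ L := by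
  induction n with
  | zero => exact h0
  | succ n ih =>
    have h1 := L.lie_mem (hL n (by omega)) (L.lie_mem (hL (n + 1) hn) (ih (by omega)))
    have h2 : ⁅g n, ⁅g (n + 1), M * g n⁆⁆ = (4 : ℝ) • (M * g (n + 1)) := by
      have hx := H.sq n (by omega)
      have ha := H.anti n hn
      set x := g n
      set y := g (n + 1)
      have hMx : x * M = M * x := (hM n (by omega)).eq.symm
      have hMy : y * M = M * y := (hM (n + 1) hn).eq.symm
      have hyx : ⁅y, M * x⁆ = -((2 : ℝ) • (M * (x * y))) := by
        rw [Ring.lie_def, ← mul_assoc, hMy, mul_assoc, mul_assoc, ← neg_eq_iff_eq_neg.2 ha]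
        rw [two_smul, mul_neg]; abel
      have hxy : x * (x * y) = -y := by rw [← mul_assoc, hx, neg_one_mul]
      have hxyx : x * y * x = y := by
        rw [ha, neg_mul, mul_assoc, hx, mul_neg_one, neg_neg]
      rw [hyx, lie_neg, lie_smul, Ring.lie_def, ← mul_assoc, hMx, mul_assoc, hxy, mul_assoc M,
        hxyx]
      rw [mul_neg]
      module
    rw [h2] at h1
    simpa [smul_smul] using L.smul_mem (1 / 4 : ℝ) h1

/-- Three commuting elements of `L` that anticommute with a common square root of `-1` in `L` have
their product in `L`. -/
theorem mul_mul_mem_of_anti (L : LieSubalgebra ℝ A) {x e₁ e₂ e₃ : A} (hx : x ∈ L) (h₁ : e₁ ∈ L)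
    (h₂ : e₂ ∈ L) (h₃ : e₃ ∈ L) (hxx : x * x = -1) (a₁ : x * e₁ = -(e₁ * x))
    (a₂ : x * e₂ = -(e₂ * x)) (a₃ : x * e₃ = -(e₃ * x)) (c₁₂ : Commute e₁ e₂) (c₁₃ : Commute e₁ e₃)
    (c₂₃ : Commute e₂ e₃) : e₁ * e₂ * e₃ ∈ L := by
  have key : ∀ {u e : A}, x * e = -(e * x) → Commute e u → ⁅e, u * x⁆ = (2 : ℝ) • (e * u * x) := by
    intro u e ha hc
    rw [Ring.lie_def, mul_assoc u, ha, mul_neg, ← mul_assoc, ← mul_assoc, hc.eq, two_smul,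
      sub_neg_eq_add]
  -- The three brackets give `8 • (e₁ * e₂ * e₃ * x)`; one more bracket with `x` removes `x` and
  -- gives `-16` times the product.
  have h4 := L.lie_mem h₁ (L.lie_mem h₂ (L.lie_mem h₃ (show 1 * x ∈ L by rwa [one_mul])))
  rw [key a₃ (Commute.one_right _), lie_smul, key a₂ (by rw [mul_one]; exact c₂₃), lie_smul,
    lie_smul, key a₁ (by rw [mul_one]; exact c₁₂.mul_right c₁₃)] at h4
  have h5 := L.lie_mem h4 hx
  have h6 : ⁅e₁ * (e₂ * (e₃ * 1)) * x, x⁆ = -((2 : ℝ) • (e₁ * e₂ * e₃)) := by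
    have h7 : x * (e₁ * e₂ * e₃) = -(e₁ * e₂ * e₃ * x) := by
      rw [← mul_assoc, ← mul_assoc, a₁, neg_mul, mul_assoc e₁, a₂, mul_neg, neg_neg, mul_assoc,
        mul_assoc e₂, a₃]
      simp only [mul_neg, mul_assoc]
    rw [mul_one, ← mul_assoc e₁, Ring.lie_def, ← mul_assoc x, h7, mul_assoc, hxx, neg_mul,
      mul_assoc _ x x, hxx, two_smul]
    simp only [mul_neg, mul_one]
    abel
  rw [smul_smul, smul_smul, smul_lie, h6, smul_neg, smul_smul] at h5
  have h8 := L.smul_mem (-(1 / 16) : ℝ) h5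
  rw [smul_neg, smul_smul, ← neg_smul] at h8
  norm_num at h8
  exact h8

/-- The identity is `⁅κ, ⁅κ * T, y⁆⁆ = -4 • (T * y)`: the control `κ` lets `T` multiply `y` although
`T` itself need not lie in `L`. -/
theorem mul_mem_of_anti (L : LieSubalgebra ℝ A) {κ T y : A} (hκ : κ ∈ L) (hκT : κ * T ∈ L)
    (hy : y ∈ L) (hsq : κ * κ = -1) (ha : y * κ = -(κ * y)) (hc : Commute κ T)
    (hc' : Commute T y) : T * y ∈ L := by
  have h1 := L.lie_mem hκ (L.lie_mem hκT hy)
  have h2 : ⁅κ * T, y⁆ = (2 : ℝ) • (κ * (T * y)) := by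
    rw [Ring.lie_def, ← mul_assoc y, ha, neg_mul, mul_assoc, mul_assoc, hc'.eq, two_smul,
      sub_neg_eq_add]
  have h3 : ⁅κ, κ * (T * y)⁆ = -((2 : ℝ) • (T * y)) := by
    have h4 : T * y * κ = -(κ * (T * y)) := by
      rw [mul_assoc, ha, mul_neg, ← mul_assoc, ← hc.eq, mul_assoc]
    rw [Ring.lie_def, mul_assoc κ, h4, mul_neg, ← mul_assoc, hsq, two_smul]
    simp only [neg_mul, one_mul]
    abel
  rw [h2, lie_smul, h3, smul_neg, smul_smul] at h1
  have h8 := L.smul_mem (-(1 / 4) : ℝ) h1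
  rw [smul_neg, smul_smul, ← neg_smul] at h8
  norm_num at h8
  exact h8

end Growth

/-! ### Independence of strings of `X` operators -/

section Strings

variable {W : Type} [Fintype W]

theorem linearIndependent_xString {ι : Type*} [Fintype ι] {R : ι → W → Bool}
    (hR : Function.Injective R) :
    LinearIndependent ℝ fun i => (Complex.I • xString (R i) : Op W) := by
  classical
  rw [Fintype.linearIndependent_iff]
  intro c hc i
  -- In the column of the all-zero bit string, `xString (R j)` has its only nonzero entry in row `R
  -- j`.
  have h1 := congrFun (congrFun hc (R i)) fun _ => false
  have h2 : ∑ j, (c j • (Complex.I • xString (R j) : Op W)) (R i) (fun _ => false) =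
      c i • Complex.I := by
    rw [Finset.sum_eq_single i]
    · simp [xString_apply]
    · intro j _ hj
      have : R i ≠ R j := fun h => hj (hR h).symm
      simp [xString_apply, this]
    · simp
  rw [Matrix.sum_apply, h2] at h1
  simpa using h1

end Strings

/-! ### Toggling bits and the exponential lower bound -/

section Spider

variable {k : ℕ} {m : Fin k → ℕ}

/-- The bit string with a single `true`. -/
def bit (s : Arm m) (w : SpiderVertex m) : Bool := decide (w = some s)

theorem frustGen_inl_some (s : Arm m) :
    frustGen some (some none) (Sum.inl (some s) : SpiderVertex m ⊕ Arm m) =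
      Complex.I • xString (bit s) := by
  rw [frustGen, pauliX_eq_xString]
  rfl

variable {L : LieSubalgebra ℝ (Op (SpiderVertex m))}
  (hL : ∀ x : SpiderVertex m ⊕ Arm m, frustGen some (some none) x ∈ L)
include hL

theorem armGen_mem (j : Fin k) (n : ℕ) (hn : n < 2 * m j) : armGen some (some none) j n ∈ L := by
  obtain ⟨x, hx⟩ := exists_armGen_eq (emb := (some : Arm m → SpiderVertex m))
    (root := some none) j n hn
  rw [hx]
  exact hL x

theorem armGen_mul_armGen_mul_armGen_mem {a b c : Fin k} (hab : a ≠ b) (hac : a ≠ c) (hbc : b ≠ c)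
    (ha : 1 ≤ m a) (n n' : ℕ) (hn : n < 2 * m b) (hn' : n' < 2 * m c) :
    armGen some (some none) a 0 * armGen some (some none) b n * armGen some (some none) c n' ∈
      L := by
  have hroot : ∀ q : Arm m, (some none : Option (SpiderVertex m)) ≠ some (some q) := by simp
  have hemb : Function.Injective (some : Arm m → SpiderVertex m) := Option.some_injective _
  have H := frustrationFamily_frustGen hroot hemb
  have hcomm : ∀ {i j : Fin k}, i ≠ j → ∀ l l', l < 2 * m i → l' < 2 * m j →
      Commute (armGen some (some none) i l : Op (SpiderVertex m)) (armGen some (some none) j l') :=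
    fun hij l l' hl hl' => armGen_commute_armGen hroot hemb hij l l' hl hl'
  have hanti : ∀ j, 1 ≤ m j → frustGen some (some none) (Sum.inl none : SpiderVertex m ⊕ Arm m) *
      armGen some (some none) j 0 = -(armGen some (some none) j 0 *
        frustGen some (some none) (Sum.inl none : SpiderVertex m ⊕ Arm m)) := by
    intro j hj
    have := armGen_even (emb := (some : Arm m → SpiderVertex m)) (root := some none) j 0 hj
    rw [mul_zero] at this
    rw [this]
    exact H.anti _ _ ((frustAdj_none_iff _).2 ⟨j, hj, rfl⟩)
  -- The central mixer term anticommutes with all three innermost edge terms. The factor of arm `b`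
  -- is put last so that it can be moved along its arm; it is then exchanged with the factor of arm
  -- `c`.
  have h0 := mul_mul_mem_of_anti L (hL (Sum.inl none)) (armGen_mem hL a 0 (by omega))
    (armGen_mem hL c 0 (by omega)) (armGen_mem hL b 0 (by omega)) (H.sq _) (hanti a ha)
    (hanti c (by omega)) (hanti b (by omega)) (hcomm hac _ _ (by omega) (by omega))
    (hcomm hab _ _ (by omega) (by omega)) (hcomm hbc.symm _ _ (by omega) (by omega))
  have h1 := (majoranaChain_armGen hroot hemb b).mul_mem_of_commute L
    (fun i hi => armGen_mem hL b i hi) (fun i hi => (hcomm hab _ _ (by omega) hi).mul_left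
      (hcomm hbc.symm _ _ (by omega) hi)) h0 n hn
  rw [mul_assoc, (hcomm hbc.symm 0 n (by omega) hn).eq, ← mul_assoc] at h1
  exact (majoranaChain_armGen hroot hemb c).mul_mem_of_commute L
    (fun i hi => armGen_mem hL c i hi) (fun i hi => (hcomm hac _ _ (by omega) hi).mul_left
      (hcomm hbc _ _ hn hi)) h1 n' hn'

/-- The innermost edge term `κ` of arm `a` is the control: it anticommutes with the string because
the string contains the first qubit of that arm but not the centre. The toggle avoids both qubits,
so it commutes with `κ` and can be repeated. -/
theorem xString_toggle_of_ne {a b c : Fin k} (hab : a ≠ b) (hac : a ≠ c) (hbc : b ≠ c)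
    (ha : 0 < m a) (s : Fin (m b)) (t : Fin (m c)) {R : SpiderVertex m → Bool}
    (hRa : R (some ⟨a, ⟨0, ha⟩⟩) = true) (hRn : R none = false) (hR : Complex.I • xString R ∈ L) :
    Complex.I • xString (fun w => (bit ⟨b, s⟩ w ^^ bit ⟨c, t⟩ w) ^^ R w) ∈ L := by
  classical
  have hroot : ∀ q : Arm m, (some none : Option (SpiderVertex m)) ≠ some (some q) := by simp
  have hemb : Function.Injective (some : Arm m → SpiderVertex m) := Option.some_injective _
  have H := frustrationFamily_frustGen hroot hemb
  set κ := frustGen some (some none) (Sum.inr ⟨a, ⟨0, ha⟩⟩ : SpiderVertex m ⊕ Arm m) with hκ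
  set T : Op (SpiderVertex m) := xString fun w => bit ⟨b, s⟩ w ^^ bit ⟨c, t⟩ w with hT
  have hsign : ∀ S : SpiderVertex m → Bool, S none = false →
      xString S * κ = (if S (some ⟨a, ⟨0, ha⟩⟩) then -1 else 1 : ℂ) • (κ * xString S) := by
    intro S hS
    rw [hκ, xString_mul_frustGen_inr, parent_zero rfl]
    simp [hS]
  have hκT : κ * T ∈ L := by
    have h1 := armGen_mul_armGen_mul_armGen_mem hL hab hac hbc ha (2 * s + 1) (2 * t + 1)
      (by omega) (by omega)
    have h2 := armGen_even (emb := (some : Arm m → SpiderVertex m)) (root := some none) a 0 ha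
    rw [mul_zero] at h2
    rw [h2, armGen_odd b s s.is_lt, armGen_odd c t t.is_lt, frustGen_inl_some, frustGen_inl_some,
      mul_assoc, smul_mul_smul_comm, xString_mul, Complex.I_mul_I, neg_one_smul, mul_neg,
      neg_mem_iff] at h1
    exact h1
  have hTκ : Commute κ T := by
    have := hsign (fun w => bit ⟨b, s⟩ w ^^ bit ⟨c, t⟩ w) (by simp [bit])
    rw [if_neg (by simp [bit, hab, hac]), one_smul] at this
    exact this.symm
  have := mul_mem_of_anti L (hL _) hκT hR (H.sq _) (by
    rw [smul_mul_assoc, hsign R hRn, if_pos hRa, neg_one_smul, smul_neg, mul_smul_comm]) hTκ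
    ((xString_commute _ _).smul_right _)
  rwa [mul_smul_comm, hT, xString_mul] at this

theorem xString_toggle {a b : Fin k} (hk : 3 ≤ k) (hm : ∀ j, 0 < m j) (hab : a ≠ b) (s : Arm m)
    (hs : s.1 ≠ a) {R : SpiderVertex m → Bool}
    (hRa : R (some ⟨a, ⟨0, hm a⟩⟩) = true) (hRn : R none = false) (hR : Complex.I • xString R ∈ L) :
    Complex.I • xString (fun w => (bit s w ^^ bit ⟨b, ⟨0, hm b⟩⟩ w) ^^ R w) ∈ L := by
  obtain ⟨j, s⟩ := s
  by_cases hj : j = b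
  · subst hj
    -- When both bits lie on one arm, a third arm supplies an auxiliary bit; it is toggled twice and
    -- so restored.
    obtain ⟨c, hc⟩ : ∃ c, c ∉ ({a, j} : Finset (Fin k)) := by
      by_contra! h
      have := Finset.card_le_card fun c (_ : c ∈ Finset.univ) => h c
      rw [Finset.card_univ, Fintype.card_fin] at this
      exact absurd (this.trans Finset.card_le_two) (by omega)
    simp only [Finset.mem_insert, Finset.mem_singleton, not_or] at hc
    have h1 := xString_toggle_of_ne hL hab (Ne.symm hc.1) (Ne.symm hc.2) (hm a) s ⟨0, hm c⟩ hRa hRn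
      hR
    have h2 := xString_toggle_of_ne hL hab (Ne.symm hc.1) (Ne.symm hc.2) (hm a) ⟨0, hm j⟩
      ⟨0, hm c⟩ (by simp [bit, hRa, hab, Ne.symm hc.1]) (by simp [bit, hRn]) h1
    convert h2 using 3
    funext w
    cases bit ⟨j, s⟩ w <;> cases bit ⟨j, ⟨0, hm j⟩⟩ w <;> cases bit ⟨c, ⟨0, hm c⟩⟩ w <;> simp
  · exact xString_toggle_of_ne hL (Ne.symm hs) hab hj (hm a) s _ hRa hRn hR

/-- Every toggle flips two bits. The first bit of arm `b` absorbs the second flip, so it is left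
uncontrolled while all other bits off arm `a` are prescribed. -/
theorem exists_xString_mem {a b : Fin k} (hk : 3 ≤ k) (hm : ∀ j, 0 < m j) (hab : a ≠ b)
    (E : Finset (Arm m)) (hE : ∀ s ∈ E, s.1 ≠ a) : ∃ R : SpiderVertex m → Bool,
      Complex.I • xString R ∈ L ∧ R (some ⟨a, ⟨0, hm a⟩⟩) = true ∧ R none = false ∧
      ∀ s : Arm m, s.1 ≠ a → s ≠ ⟨b, ⟨0, hm b⟩⟩ → (R (some s) = true ↔ s ∈ E) := by
  induction E using Finset.induction_on with
  | empty =>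
    refine ⟨bit ⟨a, ⟨0, hm a⟩⟩, ?_, by simp [bit], by simp [bit], fun s hs _ => ?_⟩
    · rw [← frustGen_inl_some]
      exact hL _
    · simp only [bit, Option.some.injEq, decide_eq_true_eq, Finset.notMem_empty, iff_false]
      rintro rfl
      exact hs rfl
  | insert t E ht ih =>
    obtain ⟨R, hR, hRa, hRn, hRE⟩ := ih fun s hs => hE s (Finset.mem_insert_of_mem hs)
    have hta := hE t (Finset.mem_insert_self _ _)
    refine ⟨_, xString_toggle hL hk hm hab t hta hRa hRn hR, ?_, by simp [bit, hRn],
      fun s hs hsb => ?_⟩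
    · have h1 : (⟨a, ⟨0, hm a⟩⟩ : Arm m) ≠ t := by
        rintro rfl
        exact hta rfl
      simp [bit, hRa, h1, hab]
    · have h1 : bit (⟨b, ⟨0, hm b⟩⟩ : Arm m) (some s) = false := by simp [bit, hsb]
      rw [h1, Finset.mem_insert]
      by_cases hst : s = t
      · subst hst
        have h2 : R (some s) = false := by
          rw [← Bool.not_eq_true, hRE s hs hsb]
          exact ht
        simp [bit, h2]
      · simp [bit, hst, hRE s hs hsb]

theorem two_pow_le_finrank {a b : Fin k} (hk : 3 ≤ k) (hm : ∀ j, 0 < m j) (hab : a ≠ b) :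
    2 ^ (∑ j, m j - m a - 1) ≤ Module.finrank ℝ L := by
  classical
  -- The freely prescribable bits: everything off arm `a` except the absorbing bit.
  set U : Finset (Arm m) := (Finset.univ.filter fun s => s.1 ≠ a).erase ⟨b, ⟨0, hm b⟩⟩ with hU
  have hmemU : ∀ s, s ∈ U ↔ s ≠ ⟨b, ⟨0, hm b⟩⟩ ∧ s.1 ≠ a := by simp [hU]
  have hcard : U.card = ∑ j, m j - m a - 1 := by
    rw [hU, Finset.card_erase_of_mem (by simp [hab.symm])]
    have h1 : (Finset.univ.filter fun s : Arm m => s.1 = a).card = m a := by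
      have : (Finset.univ.filter fun s : Arm m => s.1 = a) =
          Finset.univ.image fun r : Fin (m a) => (⟨a, r⟩ : Arm m) := by
        ext ⟨j, r⟩
        simp only [Finset.mem_filter_univ, Finset.mem_image, Finset.mem_univ, true_and]
        constructor
        · rintro rfl
          exact ⟨r, rfl⟩
        · rintro ⟨r', h⟩
          exact (Sigma.mk.inj h).1.symm
      rw [this, Finset.card_image_of_injective _ sigma_mk_injective, Finset.card_univ,
        Fintype.card_fin]
    have h2 := Finset.card_filter_add_card_filter_not (s := (Finset.univ : Finset (Arm m)))
      fun s => s.1 = a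
    rw [h1, Finset.card_univ, Fintype.card_sigma] at h2
    simp only [Fintype.card_fin] at h2
    simp only [ne_eq]
    omega
  have key : ∀ E : U.powerset, ∃ R : SpiderVertex m → Bool, Complex.I • xString R ∈ L ∧
      ∀ s ∈ U, (R (some s) = true ↔ s ∈ E.val) := by
    intro E
    have hEU := Finset.mem_powerset.1 E.2
    obtain ⟨R, hR, -, -, h⟩ := exists_xString_mem hL hk hm hab E.val fun s hs =>
      ((hmemU s).1 (hEU hs)).2
    exact ⟨R, hR, fun s hs => h s ((hmemU s).1 hs).2 ((hmemU s).1 hs).1⟩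
  choose R hR hRE using key
  have hinj : Function.Injective R := by
    intro E F hEF
    apply Subtype.ext
    ext s
    by_cases hs : s ∈ U
    · rw [← hRE E s hs, ← hRE F s hs, hEF]
    · exact iff_of_false (fun h => hs (Finset.mem_powerset.1 E.2 h))
        fun h => hs (Finset.mem_powerset.1 F.2 h)
  have hli : LinearIndependent ℝ fun E => (⟨Complex.I • xString (R E), hR E⟩ : L) :=
    LinearIndependent.of_comp L.toSubmodule.subtype (linearIndependent_xString hinj)
  have := hli.fintype_card_le_finrank
  rwa [Fintype.card_coe, Finset.card_powerset, hcard] at this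

omit hL in
theorem exponential_le_finrank_stdDLA (hk : 3 ≤ k) (hm : ∀ j, 1 ≤ m j)
    (hinj : Function.Injective m) :
    1 / 2 * √2 ^ (∑ j, m j) ≤ (Module.finrank ℝ (stdDLA (spider m)) : ℝ) := by
  have : Nonempty (Fin k) := ⟨⟨0, by omega⟩⟩
  obtain ⟨a, ha⟩ := Finite.exists_min m
  have : Nontrivial (Fin k) := Fin.nontrivial_iff_two_le.2 (by omega)
  obtain ⟨b, hba⟩ := exists_ne a
  have h1 := two_pow_le_finrank (frustGen_mem_stdDLA hk hm hinj) hk hm hba.symm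
  have h2 : m a + m b ≤ ∑ j, m j := by
    rw [← Finset.sum_pair hba.symm]
    exact Finset.sum_le_sum_of_subset (Finset.subset_univ _)
  have h3 := ha b
  have h4 := hm a
  set n := ∑ j, m j
  -- Since `a` is a shortest arm, `2 * m a ≤ m a + m b ≤ n`, hence `n ≤ 2 * (n - m a)`. The
  -- uncontrolled bit costs the constant `1 / 2`.
  have h5 : √2 ^ n ≤ (2 : ℝ) ^ (n - m a) := by
    calc √2 ^ n ≤ √2 ^ (2 * (n - m a)) :=
          pow_le_pow_right₀ (Real.one_le_sqrt.2 one_le_two) (by omega)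
      _ = 2 ^ (n - m a) := by rw [pow_mul, Real.sq_sqrt zero_le_two]
  have h6 : (2 : ℝ) ^ (n - m a) = 2 * 2 ^ (n - m a - 1) := by
    rw [← pow_succ']
    congr 1
    omega
  calc 1 / 2 * √2 ^ n ≤ (2 : ℝ) ^ (n - m a - 1) := by linarith
    _ ≤ _ := by exact_mod_cast h1

end Spider

end QAOA

end

/-! ### The main theorem -/

theorem mainTheorem6 :
    (∀ (k : ℕ) (m : Fin k → ℕ), (∀ j, 1 ≤ m j) → Function.Injective m →
      QAOA.reducedStdDLA (QAOA.spider m) (QAOA.spiderCentre m) =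
          QAOA.reducedFreeDLA (QAOA.spider m) (QAOA.spiderCentre m) ∧
        Nonempty (QAOA.reducedStdDLA (QAOA.spider m) (QAOA.spiderCentre m) ≃ₗ⁅ℝ⁆
          (⨁ j : Fin k, LieAlgebra.Orthogonal.so (Fin (2 * m j + 1)) ℝ)) ∧
        Module.finrank ℝ (QAOA.reducedStdDLA (QAOA.spider m) (QAOA.spiderCentre m)) =
          2 * ∑ j, m j ^ 2 + ∑ j, m j ∧
        2 * ∑ j, m j ^ 2 + ∑ j, m j ≤ 2 * (∑ j, m j) ^ 2 + ∑ j, m j) ∧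
    (∃ c a : ℝ, 0 < c ∧ 1 < a ∧
      ∀ (k : ℕ) (m : Fin k → ℕ), 3 ≤ k → (∀ j, 1 ≤ m j) → Function.Injective m →
        c * a ^ (∑ j, m j) ≤
          (Module.finrank ℝ (QAOA.stdDLA (QAOA.spider m)) : ℝ)) := by
  refine ⟨fun k m _ hinj => ?_, 1 / 2, √2, by norm_num, Real.one_lt_sqrt_two,
    fun k m hk hm hinj => QAOA.exponential_le_finrank_stdDLA hk hm hinj⟩
  rw [QAOA.reducedStdDLA_eq_reducedFreeDLA hinj]
  refine ⟨rfl, ⟨QAOA.reducedFreeDLAEquiv m⟩, QAOA.finrank_reducedFreeDLA m, ?_⟩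
  have := QAOA.sum_sq_le_sq_sum m
  omega
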